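/- Let $p$ be a prime, $L$ a finite extension of $\mathbb{Q}_p$ with the norm $|\cdot|$ extending the $p$-adic norm, $\mathcal{O}$ its ring of integers, $\varpi$ a uniformizer and $k$ its residue field. Let $G=\mathrm{GL}_2(\mathbb{Q}_p)$ and $K=\mathrm{GL}_2(\mathbb{Z}_p)$. Let $\tau\hookrightarrow\Omega$ be a $G$-equivariant injection of smooth $k$-representations of $G$ such that $\Omega|_K$ is an injective envelope of the $K$-socle of $\tau$ in the category of smooth $k$-representations of $K$ and such that $\left(\begin{smallmatrix} p&0\\0&p\end{smallmatrix}\right)$ acts trivially on $\Omega$. Let $(E,\|\cdot\|)$ be an admissible unitary $L$-Banach space representation of $G$ with $G$-invariant norm $\|\cdot\|$ lifting $\Omega$; that is, $\|E\|\subseteq|L|$, the matrix $\left(\begin{smallmatrix} p&0\\0&p\end{smallmatrix}\right)$ acts trivially on $E$, and the reduction $E^0/\varpi E^0$ of the unit ball $E^0=\{x\in E:\|x\|\le 1\}$ is isomorphic to $\Omega$ as a $G$-representation. (Here $E$ is an ultrametric $L$-Banach space on which $G$ acts continuously; admissible means that for some open bounded $G$-invariant $\mathcal{O}$-lattice $\Theta\subset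 E$ the reduction $\Theta/\varpi\Theta$ is an admissible smooth representation, i.e. it is smooth and its invariants under every open subgroup of $G$ are finite dimensional over $k$.) Then there is a positive integer $r$ such that $(E,\|\cdot\|)$ is isometrically and $K$-equivariantly isomorphic to a direct summand of $\mathcal{C}(K,L)^{\oplus r}$, that is, to a closed $K$-invariant subspace having a closed $K$-invariant complement. Here $\mathcal{C}(K,L)$ is the space of continuous functions $K\to L$ with the supremum norm, on which $K$ acts by right translation, and $\mathcal{C}(K,L)^{\oplus r}$ carries the maximum of the norms of the components. -/

import Mathlib

universe u v w

noncomputable section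

namespace PadicLift

open Representation Matrix

/-! ### Smooth representations -/

section Smooth

variable {k : Type u} [Field k] {Γ : Type v} [Group Γ]

/-- A representation is smooth if the stabiliser of every vector is open. -/
def IsSmooth [TopologicalSpace Γ] {V : Type w} [AddCommGroup V] [Module k V]
    (ρ : Representation k Γ V) : Prop :=
  ∀ x : V, IsOpen {g : Γ | ρ g x = x}

/-- A smooth representation is admissible if the invariants of every open subgroup are
finite dimensional. -/
structure IsAdmissibleSmooth [TopologicalSpace Γ] {V : Type w} [AddCommGroup V] [Module k V]
    (ρ : Representation k Γ V) : Prop where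
  smooth : IsSmooth ρ
  finite_invariants : ∀ H : Subgroup Γ, IsOpen (H : Set Γ) →
    FiniteDimensional k (invariants (ρ.comp H.subtype))

/-- The socle: the sum of all irreducible subrepresentations. -/
def socle {V : Type w} [AddCommGroup V] [Module k V] (ρ : Representation k Γ V) :
    Subrepresentation ρ where
  toSubmodule := ⨆ W : {W : Subrepresentation ρ // IsIrreducible W.toRepresentation},
    W.1.toSubmodule
  apply_mem_toSubmodule g x hx := by
    have h : (⨆ W : {W : Subrepresentation ρ // IsIrreducible W.toRepresentation},
        W.1.toSubmodule) ≤ (⨆ W : {W : Subrepresentation ρ //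
          IsIrreducible W.toRepresentation}, W.1.toSubmodule).comap (ρ g) :=
      iSup_le fun W y hy => Submodule.mem_iSup_of_mem W (W.1.apply_mem_toSubmodule g hy)
    exact h hx

/-- `ρ` is an injective object of the category of smooth `k`-representations of `Γ`
(the monomorphisms of that category are the injective intertwining maps). -/
structure IsInjectiveSmooth [TopologicalSpace Γ] {V : Type u} [AddCommGroup V] [Module k V]
    (ρ : Representation k Γ V) : Prop where
  smooth : IsSmooth ρ
  exists_extension : ∀ (A B : Type u) [AddCommGroup A] [Module k A] [AddCommGroup B] [Module k B]
    (α : Representation k Γ A) (β : Representation k Γ B), IsSmooth α → IsSmooth β →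
    ∀ (i : IntertwiningMap α β) (f : IntertwiningMap α ρ), Function.Injective i →
      ∃ h : IntertwiningMap β ρ, ∀ a : A, h (i a) = f a

/-- `ρ` is an injective envelope of `σ` in the category of smooth `k`-representations of `Γ`:
it is an injective object and admits an essential embedding of `σ`. -/
def IsInjectiveEnvelope [TopologicalSpace Γ] {U V : Type u} [AddCommGroup U] [Module k U]
    [AddCommGroup V] [Module k V] (σ : Representation k Γ U) (ρ : Representation k Γ V) : Prop :=
  IsInjectiveSmooth ρ ∧ ∃ j : IntertwiningMap σ ρ, Function.Injective j ∧
    ∀ X : Subrepresentation ρ, X ≠ ⊥ → X ⊓ j.range ≠ ⊥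

end Smooth

/-! ### Lattices in Banach spaces and their reductions -/

section Banach

variable (L : Type u) [NormedField L] [IsUltrametricDist L]

/-- The ring of integers `{a : L | ‖a‖ ≤ 1}` of a nonarchimedean field. -/
abbrev Integers : ValuationSubring L := (NormedField.valuation (K := L)).valuationSubring

theorem mem_integers {a : L} : a ∈ Integers L ↔ ‖a‖ ≤ 1 := by
  simp [Integers, Valuation.mem_valuationSubring_iff, ← NNReal.coe_le_coe]

/-- The residue field. -/
abbrev Residue : Type u := IsLocalRing.ResidueField (Integers L)

/-- The maximal ideal of the ring of integers (generated by any uniformizer). -/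
abbrev MaxIdeal : Ideal (Integers L) := IsLocalRing.maximalIdeal (Integers L)

variable {L}
variable {Γ : Type v} [Group Γ]
variable {E : Type w} [NormedAddCommGroup E] [NormedSpace L E]

/-- The unit ball `{x : E | ‖x‖ ≤ 1}`, a module over the ring of integers. -/
def unitBall (L : Type u) [NormedField L] [IsUltrametricDist L]
    (E : Type w) [NormedAddCommGroup E] [NormedSpace L E] [IsUltrametricDist E] :
    Submodule (Integers L) E where
  carrier := {x | ‖x‖ ≤ 1}
  zero_mem' := by simp
  add_mem' {x y} hx hy := (IsUltrametricDist.norm_add_le_max x y).trans (max_le hx hy)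
  smul_mem' a x hx := by
    have h : ‖(a : L) • x‖ ≤ 1 := by
      rw [norm_smul]
      exact mul_le_one₀ ((mem_integers L).1 a.2) (norm_nonneg _) hx
    exact h

/-- The reduction `Θ / ϖΘ` of a module `Θ` over the ring of integers, a vector space over the
residue field. -/
def Reduction (Θ : Submodule (Integers L) E) : Type w :=
  Θ ⧸ (MaxIdeal L • ⊤ : Submodule (Integers L) Θ)

instance (Θ : Submodule (Integers L) E) : AddCommGroup (Reduction Θ) :=
  inferInstanceAs (AddCommGroup (Θ ⧸ (MaxIdeal L • ⊤ : Submodule (Integers L) Θ)))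

instance (Θ : Submodule (Integers L) E) : Module (Integers L) (Reduction Θ) :=
  inferInstanceAs (Module (Integers L) (Θ ⧸ (MaxIdeal L • ⊤ : Submodule (Integers L) Θ)))

instance (Θ : Submodule (Integers L) E) : Module (Residue L) (Reduction Θ) :=
  inferInstanceAs (Module (Integers L ⧸ MaxIdeal L)
    (Θ ⧸ (MaxIdeal L • ⊤ : Submodule (Integers L) Θ)))

/-- The projection `Θ → Θ / ϖΘ`. -/
def Reduction.mk (Θ : Submodule (Integers L) E) : Θ →ₗ[Integers L] Reduction Θ :=
  Submodule.mkQ (MaxIdeal L • ⊤ : Submodule (Integers L) Θ)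

theorem Reduction.mk_surjective (Θ : Submodule (Integers L) E) :
    Function.Surjective (Reduction.mk Θ) :=
  Submodule.mkQ_surjective _

theorem Reduction.residue_smul (Θ : Submodule (Integers L) E) (a : Integers L) (x : Reduction Θ) :
    IsLocalRing.residue (Integers L) a • x = a • x :=
  rfl

/-- The action of a single operator of `E` preserving `Θ` on the reduction `Θ / ϖΘ`. -/
def reductionMap (Θ : Submodule (Integers L) E) (T : E →ₗ[L] E) (hT : ∀ x ∈ Θ, T x ∈ Θ) :
    Reduction Θ →ₗ[Residue L] Reduction Θ :=
  let T₀ : Θ →ₗ[Integers L] Θ := (T.restrictScalars (Integers L)).restrict hT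
  let T₁ : Reduction Θ →ₗ[Integers L] Reduction Θ :=
    Submodule.mapQ (MaxIdeal L • ⊤) (MaxIdeal L • ⊤) T₀ (by
      rw [← Submodule.map_le_iff_le_comap, Submodule.map_smul'']
      exact Submodule.smul_mono le_rfl le_top)
  { toFun := T₁
    map_add' := T₁.map_add
    map_smul' := fun c x => by
      obtain ⟨a, rfl⟩ := IsLocalRing.residue_surjective c
      exact T₁.map_smul a x }

theorem reductionMap_mk (Θ : Submodule (Integers L) E) (T : E →ₗ[L] E)
    (hT : ∀ x ∈ Θ, T x ∈ Θ) (x : Θ) :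
    reductionMap Θ T hT (Reduction.mk Θ x) = Reduction.mk Θ ⟨T x, hT x x.2⟩ := rfl

/-- The representation on `Θ / ϖΘ` over the residue field induced by a representation on `E`
which preserves `Θ`. -/
def reduction (ρ : Representation L Γ E) (Θ : Submodule (Integers L) E)
    (hΘ : ∀ g, ∀ x ∈ Θ, ρ g x ∈ Θ) : Representation (Residue L) Γ (Reduction Θ) where
  toFun g := reductionMap Θ (ρ g) (hΘ g)
  map_one' := by
    refine LinearMap.ext fun x => ?_
    obtain ⟨x, rfl⟩ := Reduction.mk_surjective Θ x
    rw [reductionMap_mk]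
    simp
  map_mul' g h := by
    refine LinearMap.ext fun x => ?_
    obtain ⟨x, rfl⟩ := Reduction.mk_surjective Θ x
    rw [Module.End.mul_apply, reductionMap_mk, reductionMap_mk, reductionMap_mk]
    simp

/-! ### Unitary Banach space representations -/

/-- `(E, ‖·‖)` is a unitary Banach space representation: the action `Γ × E → E` is continuous and
the norm is invariant. (`E` is assumed to be a Banach space where this is used.) -/
structure IsUnitary [TopologicalSpace Γ] (ρ : Representation L Γ E) : Prop where
  continuous : Continuous fun q : Γ × E => ρ q.1 q.2
  norm_map : ∀ g x, ‖ρ g x‖ = ‖x‖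

theorem IsUnitary.unitBall_stable [TopologicalSpace Γ] [IsUltrametricDist E]
    {ρ : Representation L Γ E} (h : IsUnitary ρ) (g : Γ) (x : E) (hx : x ∈ unitBall L E) :
    ρ g x ∈ unitBall L E :=
  (h.norm_map g x).trans_le hx

/-- A unitary Banach space representation is admissible if the reduction `Θ / ϖΘ` of some
invariant open bounded lattice `Θ` is an admissible smooth representation. -/
structure IsAdmissibleUnitary [TopologicalSpace Γ] (ρ : Representation L Γ E) : Prop
    extends IsUnitary ρ where
  exists_lattice : ∃ (Θ : Submodule (Integers L) E) (hΘ : ∀ g, ∀ x ∈ Θ, ρ g x ∈ Θ),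
    IsOpen (Θ : Set E) ∧ Bornology.IsBounded (Θ : Set E) ∧ IsAdmissibleSmooth (reduction ρ Θ hΘ)

/-- `ρ` is isometrically and equivariantly isomorphic to a direct summand of `σ`, i.e. to a closed
invariant subspace of `σ` which has a closed invariant complement. -/
def IsIsometricToDirectSummand {F : Type w} [NormedAddCommGroup F] [NormedSpace L F]
    (ρ : Representation L Γ E) (σ : Representation L Γ F) : Prop :=
  ∃ X Y : Subrepresentation σ, IsClosed (X : Set F) ∧ IsClosed (Y : Set F) ∧
    IsCompl X.toSubmodule Y.toSubmodule ∧
    ∃ φ : E ≃ₗᵢ[L] X.toSubmodule, ∀ g x, φ (ρ g x) = X.toRepresentation g (φ x)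

/-- The representation `𝒞(Γ, L)^{⊕ r}`, on which `Γ` acts by right translation,
`(h f)(g) = f (g h)`. For compact `Γ` the type `Fin r → C(Γ, L)` carries the supremum norm. -/
def continuousFunctions (L : Type u) [NormedField L] (Γ : Type v) [Group Γ] [TopologicalSpace Γ]
    [ContinuousMul Γ] (r : ℕ) : Representation L Γ (Fin r → C(Γ, L)) where
  toFun h :=
    { toFun := fun f i => (f i).comp ⟨fun g => g * h, continuous_mul_const h⟩
      map_add' := fun _ _ => rfl
      map_smul' := fun _ _ => rfl }
  map_one' := by
    ext f i g
    simp
  map_mul' h₁ h₂ := by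
    ext f i g
    simp [mul_assoc]

end Banach

/-! ### The groups -/

section Groups

variable (p : ℕ) [Fact p.Prime]

/-- `G = GL₂(ℚ_p)`. -/
abbrev G : Type := GL (Fin 2) ℚ_[p]

/-- `K = GL₂(ℤ_p)`. -/
abbrev K : Type := GL (Fin 2) ℤ_[p]

instance : CompactSpace (K p) :=
  haveI : CompactSpace (Matrix (Fin 2) (Fin 2) ℤ_[p]) :=
    inferInstanceAs (CompactSpace (Fin 2 → Fin 2 → ℤ_[p]))
  inferInstance

/-- The inclusion of `K` in `G`. -/
def inclK : K p →* G p := Matrix.GeneralLinearGroup.map (algebraMap ℤ_[p] ℚ_[p])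

/-- The scalar matrix with diagonal entries `p`. -/
def scalarP : G p :=
  Matrix.GeneralLinearGroup.scalar (Fin 2)
    (Units.mk0 (p : ℚ_[p]) (Nat.cast_ne_zero.2 (Fact.out : p.Prime).ne_zero))

variable {p}

/-- Restriction of a representation from `G` to `K`. -/
def resK {k : Type u} [CommSemiring k] {V : Type v} [AddCommMonoid V] [Module k V]
    (ρ : Representation k (G p) V) : Representation k (K p) V :=
  ρ.comp (inclK p)

end Groups

end PadicLift

end

/-!
# Lifts of injective reductions are direct summands of spaces of continuous functions

Write `M` for the reduction of the unit ball of `E`, as a representation of `K`; it is an injective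
object of the category of smooth representations over the residue field `k`. The theorem is a
lifting argument from `k` to `L`. It rests on Frobenius reciprocity: an equivariant map from a
representation to continuous functions is the same as a family of functionals, and functionals on
the reduction of a unit ball lift to functionals of norm at most `1`
(`IsUniformizer.exists_lift_functional`, by orthonormal bases).

Suppose that finitely many functionals on `M` are given whose `K`-translates separate vectors. They
give an embedding `φ` of `M` in the reduction of `𝒞(K, L)^{⊕ r}`, which lifts to an equivariant map
`Φ` from `E` to `𝒞(K, L)^{⊕ r}`. As `M` is injective, `φ` has a retraction `π`. The endomorphism
`φ ∘ π` is again given by functionals, so it lifts to an equivariant operator, and as it is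
idempotent, Newton's iteration improves this operator to an equivariant idempotent `B`
(`exists_idempotent_norm_sub_le`). The reduction of `B ∘ Φ` is `φ`, an isomorphism onto the range of
the reduction of `B`; hence `B ∘ Φ` is isometric, and it maps `E` onto the range of `B` by
successive approximation (`IsUniformizer.isIsometricToDirectSummand`).

It remains to find the functionals. The first congruence subgroup `H` of `K` is pro-`p`, so that a
nonzero smooth representation in characteristic `p` has nonzero `H`-invariants
(`IsSmooth.exists_fixed_vector`), and functionals separating the `H`-invariants of `M` suffice
(`exists_separating_functionals`). These invariants are finite in number, although admissibility
speaks of some lattice `Θ` other than the unit ball: since `M` is injective, a relative `H¹`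
vanishes and the invariants of `M` lift to vectors invariant modulo any power of `ϖ`, whereas
`Θ / ϖⁿΘ` has only finitely many `H`-invariants for every `n` (`IsUniformizer.finite_invariants`).
-/

namespace PadicLift

open Representation Filter Topology

/-! ### Uniformizers and reductions of unit balls -/

section Uniformizer

variable {L : Type u} [NormedField L]

/-- `ϖ` is a uniformizer of the discretely valued field `L`: a nonzero element whose norm is the
largest one below `1`. -/
structure IsUniformizer (ϖ : L) : Prop where
  ne_zero : ϖ ≠ 0
  norm_lt_one : ‖ϖ‖ < 1
  norm_le : ∀ a : L, ‖a‖ < 1 → ‖a‖ ≤ ‖ϖ‖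

theorem IsUniformizer.norm_pos {ϖ : L} (hϖ : IsUniformizer ϖ) : 0 < ‖ϖ‖ :=
  norm_pos_iff.2 hϖ.ne_zero

theorem IsUniformizer.tendsto_pow {ϖ : L} (hϖ : IsUniformizer ϖ) :
    Tendsto (fun n : ℕ => ‖ϖ‖ ^ n) atTop (𝓝 0) :=
  tendsto_pow_atTop_nhds_zero_of_lt_one (norm_nonneg _) hϖ.norm_lt_one

variable {V : Type v} [NormedAddCommGroup V] [NormedSpace L V]
variable {ϖ : L}

theorem IsUniformizer.norm_inv_pow_smul_le (hϖ : IsUniformizer ϖ) {n : ℕ} {x : V} {c : ℝ} :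
    ‖(ϖ ^ n)⁻¹ • x‖ ≤ c ↔ ‖x‖ ≤ ‖ϖ‖ ^ n * c := by
  rw [norm_smul, norm_inv, norm_pow, inv_mul_le_iff₀ (pow_pos hϖ.norm_pos n)]

theorem IsUniformizer.exists_pow_mul_le (hϖ : IsUniformizer ϖ) (C : ℝ) {ε : ℝ} (hε : 0 < ε) :
    ∃ n : ℕ, ‖ϖ‖ ^ n * C ≤ ε := by
  have h : Tendsto (fun n : ℕ => ‖ϖ‖ ^ n * C) atTop (𝓝 0) := by
    simpa using hϖ.tendsto_pow.mul_const C
  exact (h.eventually (Iic_mem_nhds hε)).exists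

/-- A subspace `S` that approximates every vector of norm at most `1` of `X` up to an error of
norm at most `‖ϖ‖` is dense in `X`: rescale the error and iterate. -/
theorem IsUniformizer.le_topologicalClosure (hϖ : IsUniformizer ϖ) {X S : Submodule L V}
    (hSX : S ≤ X) (h : ∀ y ∈ X, ‖y‖ ≤ 1 → ∃ s ∈ S, ‖y - s‖ ≤ ‖ϖ‖) :
    X ≤ S.topologicalClosure := by
  have key : ∀ n : ℕ, ∀ y ∈ X, ‖y‖ ≤ 1 → ∃ s ∈ S, ‖y - s‖ ≤ ‖ϖ‖ ^ n := by
    intro n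
    induction n with
    | zero => exact fun y _ hy1 => ⟨0, S.zero_mem, by simpa using hy1⟩
    | succ n ih =>
      intro y hy hy1
      obtain ⟨s, hs, hys⟩ := ih y hy hy1
      obtain ⟨t, ht, hyt⟩ := h ((ϖ ^ n)⁻¹ • (y - s))
        (X.smul_mem _ (X.sub_mem hy (hSX hs))) (by rw [hϖ.norm_inv_pow_smul_le]; simpa using hys)
      refine ⟨s + ϖ ^ n • t, S.add_mem hs (S.smul_mem _ ht), ?_⟩
      rw [pow_succ, ← hϖ.norm_inv_pow_smul_le]
      rwa [← sub_sub, smul_sub _ (y - s), inv_smul_smul₀ (pow_ne_zero _ hϖ.ne_zero)]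
  intro y hy
  obtain ⟨m, hm⟩ := hϖ.exists_pow_mul_le ‖y‖ one_pos
  have hmem : ϖ ^ m • y ∈ S.topologicalClosure := by
    rw [← SetLike.mem_coe, Submodule.topologicalClosure_coe, Metric.mem_closure_iff]
    intro ε hε
    obtain ⟨n, hn⟩ := (hϖ.tendsto_pow.eventually (Iio_mem_nhds hε)).exists
    obtain ⟨s, hs, hys⟩ := key n (ϖ ^ m • y) (X.smul_mem _ hy) (by rwa [norm_smul, norm_pow])
    exact ⟨s, hs, by rw [dist_eq_norm]; exact hys.trans_lt hn⟩
  have := S.topologicalClosure.smul_mem (ϖ ^ m)⁻¹ hmem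
  rwa [inv_smul_smul₀ (pow_ne_zero _ hϖ.ne_zero)] at this

/-- When every norm of `V` is the norm of a scalar, a linear map is bounded by its values on the
unit ball. -/
theorem norm_le_mul_of_unitBall {W : Type w} [NormedAddCommGroup W] [NormedSpace L W]
    (hV : ∀ x : V, ∃ a : L, ‖x‖ = ‖a‖) (T : V →ₗ[L] W) {c : ℝ}
    (h : ∀ x, ‖x‖ ≤ 1 → ‖T x‖ ≤ c) (x : V) : ‖T x‖ ≤ c * ‖x‖ := by
  obtain ⟨a, ha⟩ := hV x
  by_cases ha0 : a = 0
  · have : x = 0 := by simpa [ha0] using ha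
    simp [this]
  · have h := h (a⁻¹ • x) (by
      rw [norm_smul, norm_inv, ha, inv_mul_cancel₀ (norm_ne_zero_iff.2 ha0)])
    rwa [map_smul, norm_smul, norm_inv, inv_mul_le_iff₀ (norm_pos_iff.2 ha0), mul_comm, ← ha] at h

variable [IsUltrametricDist L]

theorem mem_maxIdeal {a : Integers L} : a ∈ MaxIdeal L ↔ ‖(a : L)‖ < 1 := by
  have ha : ‖(a : L)‖ ≤ 1 := (mem_integers L).1 a.2
  rw [IsLocalRing.mem_maximalIdeal, mem_nonunits_iff, ← not_le, not_iff_not]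
  constructor
  · rintro ⟨u, rfl⟩
    have h : ‖((u : Integers L) : L)‖ * ‖(((u⁻¹ : (Integers L)ˣ) : Integers L) : L)‖ = 1 := by
      rw [← norm_mul]
      exact (congrArg (fun x : Integers L => ‖(x : L)‖) u.mul_inv).trans norm_one
    have h' : ‖(((u⁻¹ : (Integers L)ˣ) : Integers L) : L)‖ ≤ 1 :=
      (mem_integers L).1 (SetLike.coe_mem _)
    nlinarith [norm_nonneg ((u : Integers L) : L)]
  · intro h
    have h1 : ‖(a : L)‖ = 1 := le_antisymm ha h
    have h0 : (a : L) ≠ 0 := by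
      intro h0
      simp [h0] at h1
    refine IsUnit.of_mul_eq_one ⟨(a : L)⁻¹, (mem_integers L).2 (by simp [h1])⟩ ?_
    ext
    simp [h0]

theorem residue_eq_zero_iff {a : Integers L} :
    IsLocalRing.residue (Integers L) a = 0 ↔ ‖(a : L)‖ < 1 := by
  rw [IsLocalRing.residue_eq_zero_iff, mem_maxIdeal]

/-- A uniformizer, as an element of the ring of integers. -/
def IsUniformizer.toInt {ϖ : L} (hϖ : IsUniformizer ϖ) : Integers L :=
  ⟨ϖ, (mem_integers L).2 hϖ.norm_lt_one.le⟩

theorem IsUniformizer.maxIdeal_eq_span {ϖ : L} (hϖ : IsUniformizer ϖ) :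
    MaxIdeal L = Ideal.span {hϖ.toInt} := by
  ext a
  rw [mem_maxIdeal, Ideal.mem_span_singleton]
  constructor
  · intro h
    refine ⟨⟨ϖ⁻¹ * a, (mem_integers L).2 ?_⟩, ?_⟩
    · rw [norm_mul, norm_inv, inv_mul_le_iff₀ hϖ.norm_pos, mul_one]
      exact hϖ.norm_le _ h
    · ext
      simp [IsUniformizer.toInt, hϖ.ne_zero]
  · rintro ⟨b, rfl⟩
    have hb : ‖(b : L)‖ ≤ 1 := (mem_integers L).1 b.2
    calc ‖((hϖ.toInt * b : Integers L) : L)‖ = ‖ϖ‖ * ‖(b : L)‖ := by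
          simp [IsUniformizer.toInt]
      _ ≤ ‖ϖ‖ := mul_le_of_le_one_right (norm_nonneg _) hb
      _ < 1 := hϖ.norm_lt_one

theorem IsUniformizer.mk_eq_zero_iff (hϖ : IsUniformizer ϖ) {Θ : Submodule (Integers L) V}
    {x : Θ} : Reduction.mk Θ x = 0 ↔ ∃ y ∈ Θ, (x : V) = ϖ • y := by
  have h : Reduction.mk Θ x = 0 ↔ x ∈ (MaxIdeal L • ⊤ : Submodule (Integers L) Θ) :=
    Submodule.Quotient.mk_eq_zero _
  rw [h, hϖ.maxIdeal_eq_span, Submodule.ideal_span_singleton_smul,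
    Submodule.mem_smul_pointwise_iff_exists]
  constructor
  · rintro ⟨y, -, rfl⟩
    exact ⟨y, y.2, rfl⟩
  · rintro ⟨y, hy, h⟩
    exact ⟨⟨y, hy⟩, trivial, Subtype.ext h.symm⟩

section UnitBall

variable [IsUltrametricDist V]

theorem IsUniformizer.unitBall_mk_eq_zero_iff (hϖ : IsUniformizer ϖ) {x : unitBall L V} :
    Reduction.mk (unitBall L V) x = 0 ↔ ‖(x : V)‖ ≤ ‖ϖ‖ := by
  rw [hϖ.mk_eq_zero_iff]
  constructor
  · rintro ⟨y, hy, h⟩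
    rw [h, norm_smul]
    exact mul_le_of_le_one_right (norm_nonneg _) hy
  · intro h
    refine ⟨ϖ⁻¹ • (x : V), ?_, (smul_inv_smul₀ hϖ.ne_zero _).symm⟩
    change ‖ϖ⁻¹ • (x : V)‖ ≤ 1
    rwa [norm_smul, norm_inv, inv_mul_le_iff₀ hϖ.norm_pos, mul_one]

theorem IsUniformizer.unitBall_mk_eq_iff (hϖ : IsUniformizer ϖ) {x y : unitBall L V} :
    Reduction.mk (unitBall L V) x = Reduction.mk (unitBall L V) y ↔ ‖(x : V) - y‖ ≤ ‖ϖ‖ := by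
  rw [← sub_eq_zero, ← map_sub, hϖ.unitBall_mk_eq_zero_iff]
  rfl

theorem mk_linearCombination {ι : Type*} (e : ι → unitBall L V) (s : Finset ι)
    (a : ι → Integers L) :
    Reduction.mk (unitBall L V) (∑ i ∈ s, a i • e i) =
      ∑ i ∈ s, IsLocalRing.residue (Integers L) (a i) • Reduction.mk (unitBall L V) (e i) := by
  rw [map_sum]
  exact Finset.sum_congr rfl fun i _ => map_smul _ _ _

/-- Vectors of the unit ball with linearly independent reductions are orthonormal; only the
inequality between the norm of a combination and those of its coefficients is stated. -/
theorem IsUniformizer.norm_coeff_le_one (hϖ : IsUniformizer ϖ) {ι : Type*} {e : ι → unitBall L V}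
    (he : LinearIndependent (Residue L) fun i => Reduction.mk (unitBall L V) (e i))
    (c : ι →₀ L) (hc : ‖Finsupp.linearCombination L (fun i => (e i : V)) c‖ ≤ 1) (i : ι) :
    ‖c i‖ ≤ 1 := by
  by_contra! hi
  have his : i ∈ c.support := by
    rw [Finsupp.mem_support_iff]
    intro h
    norm_num [h] at hi
  obtain ⟨j, hj, hmax⟩ := c.support.exists_max_image (fun i => ‖c i‖) ⟨i, his⟩
  have hj1 : 1 < ‖c j‖ := hi.trans_le (hmax i his)
  have hj0 : c j ≠ 0 := Finsupp.mem_support_iff.1 hj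
  -- After division by the largest coefficient the combination reduces to a nontrivial relation.
  have hd : ∀ i, ‖(c j)⁻¹ * c i‖ ≤ 1 := by
    intro i
    rw [norm_mul, norm_inv, inv_mul_le_iff₀ (by positivity), mul_one]
    by_cases h : i ∈ c.support
    · exact hmax i h
    · rw [Finsupp.notMem_support_iff.1 h]
      simp
  let d : ι → Integers L := fun i => ⟨(c j)⁻¹ * c i, (mem_integers L).2 (hd i)⟩
  have hsum : ((∑ i ∈ c.support, d i • e i : unitBall L V) : V) =
      (c j)⁻¹ • Finsupp.linearCombination L (fun i => (e i : V)) c := by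
    rw [Finsupp.linearCombination_apply, Finsupp.sum, Finset.smul_sum,
      AddSubmonoidClass.coe_finsetSum]
    exact Finset.sum_congr rfl fun i _ => (smul_smul _ _ _).symm
  have hzero : Reduction.mk (unitBall L V) (∑ i ∈ c.support, d i • e i) = 0 := by
    rw [hϖ.unitBall_mk_eq_zero_iff, hsum, norm_smul]
    refine (mul_le_of_le_one_right (norm_nonneg _) hc).trans (hϖ.norm_le _ ?_)
    rw [norm_inv]
    exact inv_lt_one_of_one_lt₀ hj1
  rw [mk_linearCombination] at hzero
  have := linearIndependent_iff'.1 he _ _ hzero j hj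
  rw [residue_eq_zero_iff] at this
  simp [d, hj0] at this

/-- Every linear functional on the reduction of the unit ball lifts to a functional of norm at
most `1`: prescribe it on lifts of a basis, which span a dense subspace. -/
theorem IsUniformizer.exists_lift_functional [CompleteSpace L] (hϖ : IsUniformizer ϖ)
    (hV : ∀ x : V, ∃ a : L, ‖x‖ = ‖a‖)
    (l : Reduction (unitBall L V) →ₗ[Residue L] Residue L) :
    ∃ Λ : V →L[L] L, (∀ x, ‖Λ x‖ ≤ ‖x‖) ∧ ∀ (x : unitBall L V) (a : Integers L),
      Λ x = a → IsLocalRing.residue (Integers L) a = l (Reduction.mk (unitBall L V) x) := by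
  classical
  let b := Module.Basis.ofVectorSpace (Residue L) (Reduction (unitBall L V))
  choose e he using fun i => Reduction.mk_surjective (unitBall L V) (b i)
  choose t ht using fun i => IsLocalRing.residue_surjective (R := Integers L) (l (b i))
  have hli : LinearIndependent (Residue L) fun i => Reduction.mk (unitBall L V) (e i) := by
    simp_rw [he]
    exact b.linearIndependent
  let Te := Finsupp.linearCombination L (fun i => (e i : V))
  let Tt := Finsupp.linearCombination L (fun i => (t i : L))
  have hcoeff := hϖ.norm_coeff_le_one hli
  have hker : LinearMap.ker Te = ⊥ := by
    rw [LinearMap.ker_eq_bot']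
    intro c hc
    ext i
    by_contra hi
    have h := hcoeff ((ϖ * c i)⁻¹ • c) (by
      change ‖Te _‖ ≤ 1
      rw [map_smul, hc]
      simp) i
    have hi' : c i ≠ 0 := hi
    simp only [Finsupp.smul_apply, smul_eq_mul, mul_inv, mul_assoc, inv_mul_cancel₀ hi', mul_one,
      norm_inv] at h
    exact absurd (one_lt_inv₀ hϖ.norm_pos |>.2 hϖ.norm_lt_one) h.not_gt
  let q := LinearEquiv.ofInjective Te (LinearMap.ker_eq_bot.1 hker)
  let f : LinearMap.range Te →ₗ[L] L := Tt ∘ₗ q.symm.toLinearMap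
  have hfq : ∀ c, f ⟨Te c, c, rfl⟩ = Tt c := by
    intro c
    change Tt (q.symm (q c)) = Tt c
    rw [q.symm_apply_apply]
  have hf1 : ∀ x : LinearMap.range Te, ‖x‖ ≤ 1 → ‖f x‖ ≤ 1 := by
    rintro ⟨_, c, rfl⟩ hx
    rw [hfq]
    change ‖Finsupp.sum c fun i a => a • (t i : L)‖ ≤ 1
    refine IsUltrametricDist.norm_sum_le_of_forall_le_of_nonneg zero_le_one fun i _ => ?_
    rw [norm_smul]
    exact mul_le_one₀ (hcoeff c hx i) (norm_nonneg _) ((mem_integers L).1 (t i).2)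
  have hf : ∀ x : LinearMap.range Te, ‖f x‖ ≤ 1 * ‖x‖ :=
    norm_le_mul_of_unitBall (V := LinearMap.range Te) (fun x => hV x) f hf1
  -- The reduction of `x` has a representative in the algebraic span of the vectors `e i`.
  have happrox : ∀ x : unitBall L V, ∃ c : Finset _ × (_ → Integers L),
      ‖(x : V) - Te (∑ i ∈ c.1, Finsupp.single i (c.2 i : L))‖ ≤ ‖ϖ‖ ∧
      IsLocalRing.residue (Integers L) (∑ i ∈ c.1, c.2 i * t i) =
        l (Reduction.mk (unitBall L V) x) := by
    intro x
    choose a ha using fun i => IsLocalRing.residue_surjective (R := Integers L)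
      (b.repr (Reduction.mk (unitBall L V) x) i)
    set s := (b.repr (Reduction.mk (unitBall L V) x)).support with hs
    have hx : Reduction.mk (unitBall L V) x = ∑ i ∈ s,
        b.repr (Reduction.mk (unitBall L V) x) i • b i := by
      conv_lhs => rw [← b.linearCombination_repr (Reduction.mk (unitBall L V) x)]
      rfl
    refine ⟨(s, a), ?_, ?_⟩
    · have h1 : Te (∑ i ∈ s, Finsupp.single i (a i : L)) =
          ((∑ i ∈ s, a i • e i : unitBall L V) : V) := by
        rw [map_sum, AddSubmonoidClass.coe_finsetSum]
        refine Finset.sum_congr rfl fun i _ => ?_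
        simp only [Te, Finsupp.linearCombination_single]
        rfl
      dsimp only
      rw [h1, ← hϖ.unitBall_mk_eq_iff, mk_linearCombination]
      simp_rw [ha, he]
      exact hx
    · conv_rhs => rw [hx]
      simp only [map_sum, map_mul, ha, ht, map_smul, smul_eq_mul]
  have hdense : DenseRange (LinearMap.range Te).subtypeL := by
    have h : (⊤ : Submodule L V) ≤ (LinearMap.range Te).topologicalClosure := by
      refine hϖ.le_topologicalClosure le_top fun y _ hy => ?_
      obtain ⟨c, hc, -⟩ := happrox ⟨y, hy⟩
      exact ⟨_, ⟨_, rfl⟩, hc⟩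
    intro y
    have hy := h (Submodule.mem_top (x := y))
    rw [← SetLike.mem_coe, Submodule.topologicalClosure_coe] at hy
    rwa [← Subtype.range_coe (s := (LinearMap.range Te : Set V))] at hy
  let F : LinearMap.range Te →L[L] L := f.mkContinuous 1 hf
  let Λ : V →L[L] L := F.extend (LinearMap.range Te).subtypeL
  have hΛ : ∀ x : LinearMap.range Te, Λ x = f x := fun x =>
    F.extend_eq hdense (isUniformEmbedding_subtype_val.isUniformInducing) x
  have hΛn : ∀ x, ‖Λ x‖ ≤ ‖x‖ := by
    intro x
    refine hdense.induction_on (p := fun x => ‖Λ x‖ ≤ ‖x‖) x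
      (isClosed_le (by fun_prop) (by fun_prop)) fun y => ?_
    change ‖Λ y‖ ≤ ‖y‖
    rw [hΛ]
    simpa using hf y
  refine ⟨Λ, hΛn, fun x a ha => ?_⟩
  obtain ⟨⟨s, c⟩, hc, hres⟩ := happrox x
  rw [← hres, ← sub_eq_zero, ← map_sub, residue_eq_zero_iff]
  dsimp only at hc ⊢
  have h1 : Λ (Te (∑ i ∈ s, Finsupp.single i (c i : L))) =
      ((∑ i ∈ s, c i * t i : Integers L) : L) := by
    rw [hΛ ⟨_, _, rfl⟩, hfq, map_sum]
    simp [Tt]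
  have h2 := hΛn (x - Te (∑ i ∈ s, Finsupp.single i (c i : L)))
  rw [map_sub, ha, h1] at h2
  exact (h2.trans hc).trans_lt hϖ.norm_lt_one

end UnitBall

end Uniformizer

/-! ### Reduction of maps of norm at most one -/

section ReductionOfMaps

variable {L : Type u} [NormedField L] [IsUltrametricDist L] {ϖ : L}
variable {V : Type v} [NormedAddCommGroup V] [NormedSpace L V] [IsUltrametricDist V]
variable {W : Type w} [NormedAddCommGroup W] [NormedSpace L W] [IsUltrametricDist W]

theorem mem_unitBall {x : V} : x ∈ unitBall L V ↔ ‖x‖ ≤ 1 := Iff.rfl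

/-- The map between the reductions of the unit balls induced by a linear map of norm at most
`1`. -/
noncomputable def redMap (T : V →ₗ[L] W) (hT : ∀ x, ‖T x‖ ≤ ‖x‖) :
    Reduction (unitBall L V) →ₗ[Residue L] Reduction (unitBall L W) :=
  let T₀ : unitBall L V →ₗ[Integers L] unitBall L W :=
    (T.restrictScalars (Integers L)).restrict fun x hx => (hT x).trans hx
  let T₁ : Reduction (unitBall L V) →ₗ[Integers L] Reduction (unitBall L W) :=
    Submodule.mapQ (MaxIdeal L • ⊤) (MaxIdeal L • ⊤) T₀ (by
      rw [← Submodule.map_le_iff_le_comap, Submodule.map_smul'']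
      exact Submodule.smul_mono le_rfl le_top)
  { toFun := T₁
    map_add' := T₁.map_add
    map_smul' := fun c x => by
      obtain ⟨a, rfl⟩ := IsLocalRing.residue_surjective c
      exact T₁.map_smul a x }

theorem redMap_mk (T : V →ₗ[L] W) (hT : ∀ x, ‖T x‖ ≤ ‖x‖) (x : unitBall L V) :
    redMap T hT (Reduction.mk (unitBall L V) x) =
      Reduction.mk (unitBall L W) ⟨T x, (hT x).trans x.2⟩ := rfl

/-- The functional on the reduction of the unit ball, with values in the residue field, induced by
a functional of norm at most `1`. -/
noncomputable def redFunctional (Λ : V →ₗ[L] L) (hΛ : ∀ x, ‖Λ x‖ ≤ ‖x‖) :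
    Reduction (unitBall L V) →ₗ[Residue L] Residue L :=
  let T₀ : unitBall L V →ₗ[Integers L] Integers L :=
    { toFun := fun x => ⟨Λ x, (mem_integers L).2 ((hΛ x).trans x.2)⟩
      map_add' := fun x y => Subtype.ext (Λ.map_add x y)
      map_smul' := fun a x => Subtype.ext (Λ.map_smul (a : L) x) }
  let T₁ : Reduction (unitBall L V) →ₗ[Integers L] Residue L :=
    Submodule.liftQ (MaxIdeal L • ⊤) (Algebra.linearMap (Integers L) (Residue L) ∘ₗ T₀) (by
      rw [Submodule.smul_le]
      intro a ha x _
      rw [LinearMap.mem_ker, LinearMap.comp_apply, map_smul, smul_eq_mul]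
      change IsLocalRing.residue (Integers L) (a * T₀ x) = 0
      rw [map_mul, (IsLocalRing.residue_eq_zero_iff a).2 ha, zero_mul])
  { toFun := T₁
    map_add' := T₁.map_add
    map_smul' := fun c x => by
      obtain ⟨a, rfl⟩ := IsLocalRing.residue_surjective c
      exact T₁.map_smul a x }

theorem redFunctional_mk (Λ : V →ₗ[L] L) (hΛ : ∀ x, ‖Λ x‖ ≤ ‖x‖) (x : unitBall L V) :
    redFunctional Λ hΛ (Reduction.mk (unitBall L V) x) =
      IsLocalRing.residue (Integers L) ⟨Λ x, (mem_integers L).2 ((hΛ x).trans x.2)⟩ := rfl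

theorem IsUniformizer.exists_redFunctional_eq [CompleteSpace L] (hϖ : IsUniformizer ϖ)
    (hV : ∀ x : V, ∃ a : L, ‖x‖ = ‖a‖)
    (l : Reduction (unitBall L V) →ₗ[Residue L] Residue L) :
    ∃ (Λ : V →L[L] L) (hΛ : ∀ x, ‖Λ x‖ ≤ ‖x‖), redFunctional Λ.toLinearMap hΛ = l := by
  obtain ⟨Λ, hΛ, h⟩ := hϖ.exists_lift_functional hV l
  refine ⟨Λ, hΛ, LinearMap.ext fun m => ?_⟩
  obtain ⟨x, rfl⟩ := Reduction.mk_surjective _ m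
  exact h x _ rfl

/-- A map of norm at most `1` with injective reduction is isometric. -/
theorem IsUniformizer.norm_map_eq_of_redMap_injective (hϖ : IsUniformizer ϖ)
    (hV : ∀ x : V, ∃ a : L, ‖x‖ = ‖a‖) (hW : ∀ x : W, ∃ a : L, ‖x‖ = ‖a‖)
    (T : V →ₗ[L] W) (hT : ∀ x, ‖T x‖ ≤ ‖x‖) (hinj : Function.Injective (redMap T hT)) (x : V) :
    ‖T x‖ = ‖x‖ := by
  have h1 : ∀ y : V, ‖y‖ = 1 → 1 ≤ ‖T y‖ := by
    intro y hy
    by_contra! hlt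
    obtain ⟨a, ha⟩ := hW (T y)
    have hTy : redMap T hT (Reduction.mk (unitBall L V) ⟨y, hy.le⟩) = 0 := by
      rw [redMap_mk, hϖ.unitBall_mk_eq_zero_iff]
      change ‖T y‖ ≤ ‖ϖ‖
      rw [ha] at hlt ⊢
      exact hϖ.norm_le a hlt
    rw [map_eq_zero_iff _ hinj, hϖ.unitBall_mk_eq_zero_iff] at hTy
    exact absurd (hy.symm.le.trans hTy) hϖ.norm_lt_one.not_ge
  refine le_antisymm (hT x) ?_
  obtain ⟨a, ha⟩ := hV x
  by_cases ha0 : a = 0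
  · rw [ha, ha0, norm_zero]
    exact norm_nonneg _
  · have h := h1 (a⁻¹ • x) (by
      rw [norm_smul, norm_inv, ha, inv_mul_cancel₀ (norm_ne_zero_iff.2 ha0)])
    rwa [map_smul, norm_smul, norm_inv, le_inv_mul_iff₀ (norm_pos_iff.2 ha0), mul_one, ← ha] at h

end ReductionOfMaps

/-! ### Lifting idempotents -/

section Idempotent

/-- In a complete ultrametric ring an element `a` of norm at most `1` with `‖a² - a‖ ≤ δ < 1` is
close to an idempotent: the iteration `a ↦ 3a² - 2a³` converges to one. The idempotent commutes
with everything that commutes with `a`. -/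
theorem exists_idempotent_norm_sub_le {R : Type*} [NormedRing R] [IsUltrametricDist R]
    [CompleteSpace R] {a : R} (ha : ‖a‖ ≤ 1) {δ : ℝ} (hδ : δ < 1) (had : ‖a * a - a‖ ≤ δ) :
    ∃ e : R, e * e = e ∧ ‖e - a‖ ≤ δ ∧ ∀ b, b * a = a * b → b * e = e * b := by
  have hδ0 : 0 ≤ δ := (norm_nonneg _).trans had
  have add_le : ∀ {c : ℝ} {x y : R}, ‖x‖ ≤ c → ‖y‖ ≤ c → ‖x + y‖ ≤ c := fun hx hy =>
    (IsUltrametricDist.norm_add_le_max _ _).trans (max_le hx hy)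
  have sub_le : ∀ {c : ℝ} {x y : R}, ‖x‖ ≤ c → ‖y‖ ≤ c → ‖x - y‖ ≤ c := fun {c x y} hx hy => by
    rw [sub_eq_add_neg]
    exact add_le hx (by rwa [norm_neg])
  have mul_le : ∀ {c : ℝ} {x y : R}, ‖x‖ ≤ 1 → ‖y‖ ≤ c → ‖x * y‖ ≤ c := fun {c x y} hx hy =>
    (norm_mul_le _ _).trans ((mul_le_of_le_one_left (norm_nonneg _) hx).trans hy)
  let step : R → R := fun x => x + ((x * x - x) - (x * (x * x - x) + x * (x * x - x)))
  have hstep : ∀ (x : R) (c : ℝ), ‖x‖ ≤ 1 → ‖x * x - x‖ ≤ c → ‖step x - x‖ ≤ c := by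
    intro x c hx hc
    rw [show step x - x = (x * x - x) - (x * (x * x - x) + x * (x * x - x)) from
      add_sub_cancel_left _ _]
    exact sub_le hc (add_le (mul_le hx hc) (mul_le hx hc))
  -- The defect `d = x² - x` of `x` becomes `4d³ - 3d²`.
  have hdefect : ∀ x : R, step x * step x - step x =
      (x * x - x) * ((x * x - x) * ((x * x - x) + (x * x - x) + (x * x - x) + (x * x - x))
        - ((x * x - x) + (x * x - x) + (x * x - x))) := by
    intro x
    simp only [step]
    noncomm_ring
  let s : ℕ → R := fun n => step^[n] a
  have hs : ∀ n, s (n + 1) = step (s n) := fun n => Function.iterate_succ_apply' step n a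
  have hbound : ∀ n, ‖s n‖ ≤ 1 ∧ ‖s n * s n - s n‖ ≤ δ ^ (n + 1) := by
    intro n
    induction n with
    | zero => exact ⟨ha, by simpa [s] using had⟩
    | succ n ih =>
      obtain ⟨h1, h2⟩ := ih
      have h3 : δ ^ (n + 1) ≤ 1 := pow_le_one₀ hδ0 hδ.le
      have h4 : δ ^ (n + 1) ≤ δ := pow_le_of_le_one hδ0 hδ.le (Nat.succ_ne_zero n)
      rw [hs]
      refine ⟨?_, ?_⟩
      · rw [← add_sub_cancel (s n) (step (s n))]
        exact add_le h1 ((hstep _ _ h1 h2).trans h3)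
      · rw [hdefect, pow_succ]
        set d := s n * s n - s n
        have hddd : ‖d + d + d‖ ≤ δ := (add_le (add_le h2 h2) h2).trans h4
        refine (norm_mul_le _ _).trans
          (mul_le_mul h2 ?_ (norm_nonneg _) (pow_nonneg hδ0 _))
        exact sub_le (mul_le (h2.trans h3) (add_le hddd (h2.trans h4))) hddd
  have hdist : ∀ n, dist (s n) (s (n + 1)) ≤ δ * δ ^ n := by
    intro n
    rw [dist_comm, dist_eq_norm, hs, mul_comm, ← pow_succ]
    exact hstep _ _ (hbound n).1 (hbound n).2
  obtain ⟨e, he⟩ := cauchySeq_tendsto_of_complete (cauchySeq_of_le_geometric δ δ hδ hdist)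
  have hdefect0 : Tendsto (fun n => s n * s n - s n) atTop (𝓝 0) := by
    refine squeeze_zero_norm (fun n => (hbound n).2) ?_
    exact (tendsto_pow_atTop_nhds_zero_of_lt_one hδ0 hδ).comp (tendsto_add_atTop_nat 1)
  refine ⟨e, ?_, ?_, fun b hb => ?_⟩
  · exact sub_eq_zero.1 (tendsto_nhds_unique ((he.mul he).sub he) hdefect0)
  · have h : ∀ n, ‖s n - a‖ ≤ δ := by
      intro n
      induction n with
      | zero => simpa [s] using hδ0
      | succ n ih =>
        rw [← sub_add_sub_cancel _ (s n), hs]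
        refine add_le (hstep _ _ (hbound n).1 ((hbound n).2.trans ?_)) ih
        exact pow_le_of_le_one hδ0 hδ.le (Nat.succ_ne_zero n)
    exact le_of_tendsto (he.sub_const a).norm (Eventually.of_forall h)
  · have h : ∀ n, b * s n = s n * b := by
      intro n
      induction n with
      | zero => exact hb
      | succ n ih =>
        rw [hs]
        have hc : Commute b (s n) := ih
        have hd : Commute b (s n * s n - s n) := (hc.mul_right hc).sub_right hc
        exact hc.add_right (hd.sub_right ((hc.mul_right hd).add_right (hc.mul_right hd)))
    exact tendsto_nhds_unique (he.const_mul b) ((he.mul_const b).congr fun n => (h n).symm)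

instance continuousLinearMap_isUltrametricDist {L : Type*} [NontriviallyNormedField L]
    {V W : Type*} [NormedAddCommGroup V] [NormedSpace L V] [NormedAddCommGroup W]
    [NormedSpace L W] [IsUltrametricDist W] : IsUltrametricDist (V →L[L] W) := by
  refine IsUltrametricDist.isUltrametricDist_of_forall_norm_add_le_max_norm fun S T => ?_
  refine ContinuousLinearMap.opNorm_le_bound _ (le_max_of_le_left (norm_nonneg _)) fun x => ?_
  refine (IsUltrametricDist.norm_add_le_max _ _).trans ?_
  rw [max_mul_of_nonneg _ _ (norm_nonneg _)]
  exact max_le_max (S.le_opNorm x) (T.le_opNorm x)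

/-- An operator `A` of norm at most `1` that is idempotent modulo `ϖ` is congruent modulo `ϖ` to an
idempotent operator, which commutes with everything that commutes with `A`. -/
theorem IsUniformizer.exists_idempotent_operator {L : Type u} [NormedField L] {ϖ : L}
    (hϖ : IsUniformizer ϖ) {V : Type v} [NormedAddCommGroup V] [NormedSpace L V]
    [IsUltrametricDist V] [CompleteSpace V] (A : V →L[L] V) (hA : ∀ x, ‖A x‖ ≤ ‖x‖)
    (hA2 : ∀ x, ‖A (A x) - A x‖ ≤ ‖ϖ‖ * ‖x‖) :
    ∃ B : V →L[L] V, (∀ x, B (B x) = B x) ∧ (∀ x, ‖B x - A x‖ ≤ ‖ϖ‖ * ‖x‖) ∧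
      ∀ T : V →L[L] V, (∀ x, T (A x) = A (T x)) → ∀ x, T (B x) = B (T x) := by
  let _ : NontriviallyNormedField L :=
    .ofNormNeOne ⟨ϖ, hϖ.ne_zero, hϖ.norm_lt_one.ne⟩
  obtain ⟨B, hB, hBA, hcomm⟩ := exists_idempotent_norm_sub_le
    (A.opNorm_le_bound zero_le_one (by simpa using hA)) hϖ.norm_lt_one
    ((A * A - A).opNorm_le_bound (norm_nonneg _) hA2)
  exact ⟨B, fun x => DFunLike.congr_fun hB x, fun x => (B - A).le_of_opNorm_le hBA x,
    fun T hT x => DFunLike.congr_fun (hcomm T (ContinuousLinearMap.ext hT)) x⟩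

end Idempotent

/-! ### Representations on continuous functions -/

section ContinuousFunctions

variable {L : Type u} [NormedField L] {ϖ : L}
variable {X : Type v} [TopologicalSpace X] [CompactSpace X]

theorem exists_norm_eq_of_continuousFunctions [Nonempty X] {r : ℕ} (f : Fin r → C(X, L)) :
    ∃ a : L, ‖f‖ = ‖a‖ := by
  have h1 : ∀ q : C(X, L), ∃ a : L, ‖q‖ = ‖a‖ := by
    intro q
    obtain ⟨g, -, hg⟩ := isCompact_univ.exists_isMaxOn Set.univ_nonempty
      (f := fun g => ‖q g‖) (by fun_prop)
    refine ⟨q g, le_antisymm ?_ (q.norm_coe_le_norm g)⟩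
    exact (ContinuousMap.norm_le _ (norm_nonneg _)).2 fun g' => hg (Set.mem_univ g')
  rcases isEmpty_or_nonempty (Fin r) with hr | hr
  · exact ⟨0, by rw [Subsingleton.elim f 0, norm_zero, norm_zero]⟩
  · obtain ⟨i, hi⟩ := Finite.exists_max fun i => ‖f i‖
    obtain ⟨a, ha⟩ := h1 (f i)
    refine ⟨a, ha ▸ le_antisymm ?_ (norm_le_pi_norm f i)⟩
    exact (pi_norm_le_iff_of_nonneg (norm_nonneg _)).2 hi

/-- Evaluation of the `i`-th component at `g`. -/
def evalComponent (L : Type u) [NormedField L] {r : ℕ} (i : Fin r) (g : X) :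
    (Fin r → C(X, L)) →ₗ[L] L where
  toFun f := f i g
  map_add' _ _ := rfl
  map_smul' _ _ := rfl

theorem norm_evalComponent_le {r : ℕ} (i : Fin r) (g : X) (f : Fin r → C(X, L)) :
    ‖evalComponent L i g f‖ ≤ ‖f‖ :=
  ((f i).norm_coe_le_norm g).trans (norm_le_pi_norm f i)

theorem IsUniformizer.eq_of_eval_eq [IsUltrametricDist L] (hϖ : IsUniformizer ϖ) {r : ℕ}
    {z z' : Reduction (unitBall L (Fin r → C(X, L)))}
    (h : ∀ i g, redFunctional (evalComponent L i g) (norm_evalComponent_le i g) z =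
      redFunctional (evalComponent L i g) (norm_evalComponent_le i g) z') : z = z' := by
  rw [← sub_eq_zero]
  have h' : ∀ i g, redFunctional (evalComponent L i g) (norm_evalComponent_le i g) (z - z') = 0 :=
    fun i g => by rw [map_sub, h, sub_self]
  generalize z - z' = y at h'
  obtain ⟨f, rfl⟩ := Reduction.mk_surjective _ y
  rw [hϖ.unitBall_mk_eq_zero_iff]
  refine (pi_norm_le_iff_of_nonneg (norm_nonneg _)).2 fun i => ?_
  refine (ContinuousMap.norm_le _ (norm_nonneg _)).2 fun g => ?_
  have := h' i g
  rw [redFunctional_mk, residue_eq_zero_iff] at this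
  exact hϖ.norm_le _ this

variable {Γ : Type v} [Group Γ] [TopologicalSpace Γ]

theorem continuousFunctions_isUnitary [CompactSpace Γ] [IsTopologicalGroup Γ] (r : ℕ) :
    IsUnitary (continuousFunctions L Γ r) where
  continuous := by
    refine continuous_pi fun i => ContinuousMap.continuous_of_continuous_uncurry _ ?_
    change Continuous fun q : (Γ × (Fin r → C(Γ, L))) × Γ => q.1.2 i (q.2 * q.1.1)
    fun_prop
  norm_map := by
    have hle : ∀ (g : Γ) (f : Fin r → C(Γ, L)), ‖continuousFunctions L Γ r g f‖ ≤ ‖f‖ := by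
      intro g f
      refine (pi_norm_le_iff_of_nonneg (norm_nonneg _)).2 fun i => ?_
      refine (ContinuousMap.norm_le _ (norm_nonneg _)).2 fun h => ?_
      exact ((f i).norm_coe_le_norm (h * g)).trans (norm_le_pi_norm f i)
    intro g f
    refine le_antisymm (hle g f) ?_
    have h := hle g⁻¹ (continuousFunctions L Γ r g f)
    rwa [inv_self_apply] at h

variable {V : Type w} [NormedAddCommGroup V] [NormedSpace L V]
variable {ρ : Representation L Γ V}

/-- Frobenius reciprocity: functionals `Λ i` on `V` give the equivariant map
`x ↦ (g ↦ Λ i (g x))` to continuous functions. -/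
def frobenius {r : ℕ} (hρ : IsUnitary ρ) (Λ : Fin r → V →L[L] L) :
    V →ₗ[L] (Fin r → C(Γ, L)) where
  toFun x i := ⟨fun g => Λ i (ρ g x),
    (Λ i).continuous.comp (hρ.continuous.comp (continuous_id.prodMk continuous_const))⟩
  map_add' x y := by
    ext i g
    simp
  map_smul' a x := by
    ext i g
    simp

theorem frobenius_equivariant [ContinuousMul Γ] {r : ℕ} (hρ : IsUnitary ρ)
    (Λ : Fin r → V →L[L] L) (g : Γ) (x : V) :
    frobenius hρ Λ (ρ g x) = continuousFunctions L Γ r g (frobenius hρ Λ x) := by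
  ext i h
  change Λ i (ρ h (ρ g x)) = Λ i (ρ (h * g) x)
  rw [map_mul, Module.End.mul_apply]

theorem norm_frobenius_le [CompactSpace Γ] {r : ℕ} (hρ : IsUnitary ρ) (Λ : Fin r → V →L[L] L)
    (hΛ : ∀ i x, ‖Λ i x‖ ≤ ‖x‖) (x : V) : ‖frobenius hρ Λ x‖ ≤ ‖x‖ := by
  refine (pi_norm_le_iff_of_nonneg (norm_nonneg _)).2 fun i => ?_
  refine (ContinuousMap.norm_le _ (norm_nonneg _)).2 fun g => ?_
  exact (hΛ i _).trans (hρ.norm_map g x).le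

theorem eval_redMap_frobenius [IsUltrametricDist L] [CompactSpace Γ]
    [IsUltrametricDist V] {r : ℕ} (hρ : IsUnitary ρ)
    (Λ : Fin r → V →L[L] L) (hΛ : ∀ i x, ‖Λ i x‖ ≤ ‖x‖) (i : Fin r) (g : Γ)
    (m : Reduction (unitBall L V)) :
    redFunctional (evalComponent L i g) (norm_evalComponent_le i g)
        (redMap (frobenius hρ Λ) (norm_frobenius_le hρ Λ hΛ) m) =
      redFunctional (Λ i).toLinearMap (hΛ i)
        (reduction ρ (unitBall L V) hρ.unitBall_stable g m) := by
  obtain ⟨x, rfl⟩ := Reduction.mk_surjective _ m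
  rfl

/-- The intertwining map of reductions induced by an equivariant map of norm at most `1`. -/
noncomputable def redIntertwining {W : Type*} [NormedAddCommGroup W] [NormedSpace L W]
    [IsUltrametricDist L] [IsUltrametricDist V] [IsUltrametricDist W] {σ : Representation L Γ W}
    (hρ : IsUnitary ρ) (hσ : IsUnitary σ) (T : V →ₗ[L] W) (hT : ∀ x, ‖T x‖ ≤ ‖x‖)
    (hTe : ∀ g x, T (ρ g x) = σ g (T x)) :
    IntertwiningMap (reduction ρ (unitBall L V) hρ.unitBall_stable)
      (reduction σ (unitBall L W) hσ.unitBall_stable) :=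
  LinearMap.intertwiningMap_of_isIntertwiningMap _ _ (redMap T hT) fun g m => by
    obtain ⟨x, rfl⟩ := Reduction.mk_surjective _ m
    exact congrArg (Reduction.mk (unitBall L W)) (Subtype.ext (hTe g x))

/-- The reduction of a unitary Banach space representation is smooth. -/
theorem IsUnitary.isSmooth_reduction [IsUltrametricDist L] [IsUltrametricDist V]
    (hϖ : IsUniformizer ϖ)
    (hρ : IsUnitary ρ) : IsSmooth (reduction ρ (unitBall L V) hρ.unitBall_stable) := by
  intro m
  obtain ⟨x, rfl⟩ := Reduction.mk_surjective _ m
  have hset : {g : Γ | reduction ρ (unitBall L V) hρ.unitBall_stable g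
      (Reduction.mk (unitBall L V) x) = Reduction.mk (unitBall L V) x} =
      (fun g => ρ g x) ⁻¹' Metric.closedBall (x : V) ‖ϖ‖ := by
    ext g
    rw [Set.mem_preimage, mem_closedBall_iff_norm]
    exact hϖ.unitBall_mk_eq_iff
  rw [hset]
  refine (IsUltrametricDist.isOpen_closedBall _ hϖ.norm_pos.ne').preimage ?_
  exact hρ.continuous.comp (continuous_id.prodMk continuous_const)

end ContinuousFunctions

/-! ### Lifting direct summands -/

section Summand

variable {L : Type u} [NormedField L] [IsUltrametricDist L] [CompleteSpace L] {ϖ : L}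

/-- Every equivariant endomorphism of the reduction of `𝒞(Γ, L)^{⊕ r}` lifts to an equivariant
operator of norm at most `1`: by Frobenius reciprocity it amounts to functionals, which lift. -/
theorem IsUniformizer.exists_lift_endomorphism (hϖ : IsUniformizer ϖ)
    {Γ : Type v} [Group Γ] [TopologicalSpace Γ] [CompactSpace Γ] [IsTopologicalGroup Γ] {r : ℕ}
    (e : IntertwiningMap
      (reduction (continuousFunctions L Γ r) (unitBall L (Fin r → C(Γ, L)))
        (continuousFunctions_isUnitary r).unitBall_stable)
      (reduction (continuousFunctions L Γ r) (unitBall L (Fin r → C(Γ, L)))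
        (continuousFunctions_isUnitary r).unitBall_stable)) :
    ∃ (A : (Fin r → C(Γ, L)) →L[L] (Fin r → C(Γ, L))) (hA : ∀ f, ‖A f‖ ≤ ‖f‖),
      (∀ g f, A (continuousFunctions L Γ r g f) = continuousFunctions L Γ r g (A f)) ∧
      ∀ z, redMap A.toLinearMap hA z = e z := by
  have hC := continuousFunctions_isUnitary (L := L) (Γ := Γ) r
  choose Λ hΛ hΛe using fun i : Fin r => hϖ.exists_redFunctional_eq
    exists_norm_eq_of_continuousFunctions
    (redFunctional (evalComponent L i (1 : Γ)) (norm_evalComponent_le i 1) ∘ₗ e.toLinearMap)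
  have hle := norm_frobenius_le hC Λ hΛ
  refine ⟨(frobenius hC Λ).mkContinuous 1 (by simpa using hle), hle,
    frobenius_equivariant hC Λ, fun z => hϖ.eq_of_eval_eq fun i g => ?_⟩
  refine (eval_redMap_frobenius hC Λ hΛ i g z).trans ?_
  rw [hΛe, LinearMap.comp_apply, IntertwiningMap.toLinearMap_apply, e.isIntertwining]
  obtain ⟨f, hf⟩ := Reduction.mk_surjective _ (e z)
  rw [← hf]
  change IsLocalRing.residue (Integers L) ⟨(f : Fin r → C(Γ, L)) i (1 * g), _⟩ =
    IsLocalRing.residue (Integers L) ⟨(f : Fin r → C(Γ, L)) i g, _⟩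
  congr 2
  rw [one_mul]

variable {Γ : Type} [Group Γ] [TopologicalSpace Γ] [CompactSpace Γ] [IsTopologicalGroup Γ]
variable {E : Type u} [NormedAddCommGroup E] [NormedSpace L E] [IsUltrametricDist E]
  [CompleteSpace E]

/-- If the reduction of `E` is injective and embeds in `𝒞(Γ, k)^{⊕ r}`, by way of functionals `l`
whose translates separate vectors, then `E` is a direct summand of `𝒞(Γ, L)^{⊕ r}`. -/
theorem IsUniformizer.isIsometricToDirectSummand (hϖ : IsUniformizer ϖ)
    (ρ : Representation L Γ E) (hρ : IsUnitary ρ) (hE : ∀ x : E, ∃ a : L, ‖x‖ = ‖a‖)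
    (hinj : IsInjectiveSmooth (reduction ρ (unitBall L E) hρ.unitBall_stable)) {r : ℕ}
    (l : Fin r → Reduction (unitBall L E) →ₗ[Residue L] Residue L)
    (hl : ∀ m, (∀ g i, l i (reduction ρ (unitBall L E) hρ.unitBall_stable g m) = 0) → m = 0) :
    IsIsometricToDirectSummand ρ (continuousFunctions L Γ r) := by
  have hC := continuousFunctions_isUnitary (L := L) (Γ := Γ) r
  have hCn := exists_norm_eq_of_continuousFunctions (L := L) (X := Γ) (r := r)
  choose Λ hΛ hΛl using fun i => hϖ.exists_redFunctional_eq hE (l i)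
  have hle := norm_frobenius_le hρ Λ hΛ
  -- The embedding `φ` of reductions and a retraction `π` of it.
  let φ := redIntertwining hρ hC (frobenius hρ Λ) hle (frobenius_equivariant hρ Λ)
  have hφ : Function.Injective φ := by
    refine (injective_iff_map_eq_zero φ).2 fun m hm => hl m fun g i => ?_
    rw [← hΛl, ← eval_redMap_frobenius]
    change redFunctional _ _ (φ m) = 0
    rw [hm, map_zero]
  obtain ⟨π, hπ⟩ := hinj.exists_extension _ _ _ _ hinj.smooth (hC.isSmooth_reduction hϖ) φ
    (IntertwiningMap.id _) hφ
  replace hπ : ∀ m, π (φ m) = m := hπ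
  obtain ⟨A, hA, hAe, hAφ⟩ := hϖ.exists_lift_endomorphism (φ.comp π)
  replace hAφ : ∀ z, redMap A.toLinearMap hA z = φ (π z) := hAφ
  have hA2 : ∀ f, ‖A (A f) - A f‖ ≤ ‖ϖ‖ * ‖f‖ := by
    refine norm_le_mul_of_unitBall hCn (A.toLinearMap ∘ₗ A.toLinearMap - A.toLinearMap)
      fun f hf => ?_
    have h : redMap A.toLinearMap hA (redMap A.toLinearMap hA (Reduction.mk (unitBall L _) ⟨f, hf⟩))
        = redMap A.toLinearMap hA (Reduction.mk (unitBall L _) ⟨f, hf⟩) := by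
      rw [hAφ, hAφ, hπ]
    exact hϖ.unitBall_mk_eq_iff.1 h
  obtain ⟨B, hBB, hBA, hBcomm⟩ := hϖ.exists_idempotent_operator A hA hA2
  have hBe : ∀ g f, B (continuousFunctions L Γ r g f) = continuousFunctions L Γ r g (B f) :=
    fun g f => ((hBcomm ((continuousFunctions L Γ r g).mkContinuous 1
      fun f => by rw [one_mul, hC.norm_map]) (fun f => (hAe g f).symm)) f).symm
  have hB : ∀ f, ‖B f‖ ≤ ‖f‖ := by
    intro f
    rw [← sub_add_cancel (B f) (A f)]
    refine (IsUltrametricDist.norm_add_le_max _ _).trans (max_le ((hBA f).trans ?_) (hA f))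
    exact mul_le_of_le_one_left (norm_nonneg _) hϖ.norm_lt_one.le
  have hBφ : ∀ z, redMap B.toLinearMap hB z = φ (π z) := by
    intro z
    rw [← hAφ]
    obtain ⟨f, rfl⟩ := Reduction.mk_surjective _ z
    refine hϖ.unitBall_mk_eq_iff.2 ((hBA f).trans ?_)
    exact mul_le_of_le_one_right (norm_nonneg _) f.2
  -- The summand is the range of the idempotent `B`, and `ψ` identifies `E` with it.
  let X : Subrepresentation (continuousFunctions L Γ r) :=
    ⟨LinearMap.eqLocus B.toLinearMap LinearMap.id, fun g f (hf : B f = f) => by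
      change B _ = _
      rw [hBe, hf]
      rfl⟩
  let Y : Subrepresentation (continuousFunctions L Γ r) :=
    ⟨LinearMap.ker B.toLinearMap, fun g f (hf : B f = 0) => by
      change B _ = _
      rw [hBe, hf, map_zero]⟩
  let ψ : E →ₗ[L] (Fin r → C(Γ, L)) := B.toLinearMap ∘ₗ frobenius hρ Λ
  have hψle : ∀ x, ‖ψ x‖ ≤ ‖x‖ := fun x => (hB _).trans (hle x)
  have hψφ : ∀ m, redMap ψ hψle m = φ m := by
    intro m
    rw [← hπ m, hπ m]
    refine Eq.trans ?_ ((hBφ (φ m)).trans (by rw [hπ]))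
    obtain ⟨x, rfl⟩ := Reduction.mk_surjective _ m
    rfl
  have hψ : ∀ x, ‖ψ x‖ = ‖x‖ := by
    refine hϖ.norm_map_eq_of_redMap_injective hE hCn ψ hψle ?_
    rwa [show ⇑(redMap ψ hψle) = φ from funext hψφ]
  have hψX : ∀ x, ψ x ∈ X.toSubmodule := fun x => hBB _
  let ψi : E →ₗᵢ[L] (Fin r → C(Γ, L)) := ⟨ψ, hψ⟩
  have hrange : X.toSubmodule ≤ LinearMap.range ψ := by
    have hclosed : IsClosed (LinearMap.range ψ : Set (Fin r → C(Γ, L))) := by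
      rw [LinearMap.coe_range]
      exact ψi.isometry.isClosedEmbedding.isClosed_range
    have hsub : LinearMap.range ψ ≤ X.toSubmodule := by
      rintro _ ⟨x, rfl⟩
      exact hψX x
    refine (hϖ.le_topologicalClosure hsub fun f hf hf1 => ?_).trans
      hclosed.submodule_topologicalClosure_eq.le
    replace hf : B f = f := hf
    obtain ⟨x, hx⟩ := Reduction.mk_surjective _ (π (Reduction.mk (unitBall L _) ⟨f, hf1⟩))
    refine ⟨ψ x, ⟨x, rfl⟩, ?_⟩
    have h : Reduction.mk (unitBall L _) ⟨f, hf1⟩ =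
        redMap ψ hψle (Reduction.mk (unitBall L _) x) := by
      rw [hψφ, hx, ← hBφ, redMap_mk]
      congr 2
      exact hf.symm
    exact hϖ.unitBall_mk_eq_iff.1 h
  let ψX : E →ₗᵢ[L] X.toSubmodule := ⟨ψ.codRestrict X.toSubmodule hψX, hψ⟩
  have hsurj : Function.Surjective ψX := by
    rintro ⟨f, hf⟩
    obtain ⟨x, rfl⟩ := hrange hf
    exact ⟨x, rfl⟩
  refine ⟨X, Y, ?_, ?_, ⟨?_, ?_⟩, LinearIsometryEquiv.ofSurjective ψX hsurj, fun g x => ?_⟩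
  · exact isClosed_eq B.continuous continuous_id
  · exact isClosed_eq B.continuous continuous_const
  · rw [Submodule.disjoint_def]
    intro f (hf : B f = f) (hf' : B f = 0)
    rw [← hf, hf']
  · rw [codisjoint_iff, eq_top_iff]
    intro f _
    rw [← add_sub_cancel (B f) f]
    refine Submodule.add_mem_sup (hBB f) ?_
    change B (f - B f) = 0
    rw [map_sub, hBB, sub_self]
  · refine Subtype.ext ?_
    change B (frobenius hρ Λ (ρ g x)) = continuousFunctions L Γ r g (B (frobenius hρ Λ x))
    rw [frobenius_equivariant, hBe]

end Summand

/-! ### Vanishing of cohomology for injective smooth representations -/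

section Coboundary

variable {k : Type u} [Field k] {Γ : Type v} [Group Γ] [TopologicalSpace Γ]

/-- The representation of `Γ` by right translation on locally constant functions with values in
a vector space. -/
def locallyConstantFunctions (k : Type u) [Field k] (Γ : Type v) [Group Γ] [TopologicalSpace Γ]
    [ContinuousMul Γ] (M : Type w) [AddCommGroup M] [Module k M] :
    Representation k Γ (LocallyConstant Γ M) where
  toFun h :=
    { toFun := fun f => f.comap ⟨fun g => g * h, continuous_mul_const h⟩
      map_add' := fun _ _ => rfl
      map_smul' := fun _ _ => rfl }
  map_one' := by
    ext f g
    simp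
  map_mul' h₁ h₂ := by
    ext f g
    exact congrArg f (mul_assoc g h₁ h₂).symm

theorem locallyConstantFunctions_isSmooth [CompactSpace Γ] [ContinuousMul Γ] (M : Type w)
    [AddCommGroup M] [Module k M] : IsSmooth (locallyConstantFunctions k Γ M) := by
  intro f
  rw [isOpen_iff_mem_nhds]
  intro h₀ hh₀
  have hf : ∀ g, f (g * h₀) = f g := fun g => LocallyConstant.congr_fun hh₀ g
  have h := isCompact_univ.eventually_forall_of_forall_eventually (x₀ := h₀)
    (P := fun h g => f (g * h) = f g) fun g _ => by
      have h1 : ∀ᶠ z : Γ × Γ in 𝓝 (h₀, g), f (z.2 * z.1) = f (g * h₀) :=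
        ((continuous_snd.mul continuous_fst : Continuous fun z : Γ × Γ => z.2 * z.1).tendsto
          (h₀, g)).eventually (f.isLocallyConstant.eventually_eq (g * h₀))
      have h2 : ∀ᶠ z : Γ × Γ in 𝓝 (h₀, g), f z.2 = f g :=
        (continuous_snd.tendsto (h₀, g)).eventually (f.isLocallyConstant.eventually_eq g)
      filter_upwards [h1, h2] with z hz1 hz2
      rw [hz1, hz2, hf]
  filter_upwards [h] with h hh
  exact LocallyConstant.ext fun g => hh g trivial

variable {M : Type w} [AddCommGroup M] [Module k M] {σ : Representation k Γ M}

theorem IsSmooth.isLocallyConstant [ContinuousMul Γ] (hσ : IsSmooth σ) (m : M) :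
    IsLocallyConstant fun g => σ g m := by
  rw [IsLocallyConstant.iff_eventually_eq]
  intro g₀
  have h : ∀ᶠ g in 𝓝 g₀, g₀⁻¹ * g ∈ {g | σ g m = m} :=
    (continuous_const_mul g₀⁻¹).continuousAt.eventually ((hσ m).mem_nhds (by simp))
  filter_upwards [h] with g hg
  have hg' : σ (g₀⁻¹ * g) m = m := hg
  conv_rhs => rw [← hg', ← Module.End.mul_apply, ← map_mul, mul_inv_cancel_left]

/-- The embedding of a smooth representation by orbit maps. -/
def IsSmooth.orbitMap [ContinuousMul Γ] (hσ : IsSmooth σ) :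
    IntertwiningMap σ (locallyConstantFunctions k Γ M) :=
  LinearMap.intertwiningMap_of_isIntertwiningMap _ _
    { toFun := fun m => ⟨fun g => σ g m, hσ.isLocallyConstant m⟩
      map_add' := fun x y => LocallyConstant.ext fun g => map_add (σ g) x y
      map_smul' := fun a x => LocallyConstant.ext fun g => map_smul (σ g) a x }
    fun g m => LocallyConstant.ext fun h => by
      change σ h (σ g m) = σ (h * g) m
      rw [map_mul, Module.End.mul_apply]

end Coboundary

/-- The relative vanishing of `H¹` for injective smooth representations: a retraction of the
orbit map sends a function `F` to a vector `m` such that, whenever translation by `h` changes `F`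
by the orbit map of `c`, the action of `h` changes `m` by `c`. -/
theorem IsInjectiveSmooth.exists_coboundary {k : Type u} [Field k] {Γ : Type} [Group Γ]
    [TopologicalSpace Γ] [CompactSpace Γ] [ContinuousMul Γ] {M : Type u} [AddCommGroup M]
    [Module k M] {σ : Representation k Γ M} (hσ : IsInjectiveSmooth σ)
    (F : LocallyConstant Γ M) :
    ∃ m, ∀ h c, (∀ g, F (g * h) - F g = σ g c) → σ h m - m = c := by
  obtain ⟨π, hπ⟩ := hσ.exists_extension _ _ _ _ hσ.smooth (locallyConstantFunctions_isSmooth M)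
    hσ.smooth.orbitMap (IntertwiningMap.id _) fun m m' h => by
      have h1 : σ 1 m = σ 1 m' := LocallyConstant.congr_fun h 1
      simpa using h1
  refine ⟨π F, fun h c hc => ?_⟩
  rw [← π.isIntertwining, ← map_sub, ← show π (hσ.smooth.orbitMap c) = c from hπ c]
  exact congrArg π (LocallyConstant.ext hc)

/-! ### Finiteness of the invariants of the reduction -/

section Finiteness

variable {L : Type u} [NormedField L] [IsUltrametricDist L] {ϖ : L}

/-- If the reduction of `E` is injective, an `H`-invariant vector modulo `ϖⁿ` can be improved to
one modulo `ϖⁿ⁺¹` without changing it modulo `ϖⁿ`. -/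
theorem IsUniformizer.improve_invariant (hϖ : IsUniformizer ϖ) {Γ : Type} [Group Γ]
    [TopologicalSpace Γ] [CompactSpace Γ] [IsTopologicalGroup Γ] {E : Type u}
    [NormedAddCommGroup E] [NormedSpace L E] [IsUltrametricDist E] {ρ : Representation L Γ E}
    (hρ : IsUnitary ρ) (hinj : IsInjectiveSmooth (reduction ρ (unitBall L E) hρ.unitBall_stable))
    {H : Subgroup Γ} (hH : IsOpen (H : Set Γ)) {n : ℕ} {x : E}
    (hx : ∀ h ∈ H, ‖ρ h x - x‖ ≤ ‖ϖ‖ ^ n) :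
    ∃ m : E, ‖m‖ ≤ 1 ∧
      ∀ h ∈ H, ‖ρ h (x - ϖ ^ n • m) - (x - ϖ ^ n • m)‖ ≤ ‖ϖ‖ ^ (n + 1) := by
  have hϖn : ϖ ^ n ≠ 0 := pow_ne_zero _ hϖ.ne_zero
  -- `t g` represents the coset `g H`.
  let t : Γ → Γ := fun g => ((g : Γ ⧸ H)).out
  have ht : ∀ g, ‖ρ g x - ρ (t g) x‖ ≤ ‖ϖ‖ ^ n := by
    intro g
    have hmem : (t g)⁻¹ * g ∈ H := QuotientGroup.eq.1 (Quotient.out_eq _)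
    have h := hx _ hmem
    rwa [← hρ.norm_map (t g), map_sub, ← Module.End.mul_apply, ← map_mul, mul_inv_cancel_left] at h
  have hthH : ∀ g, ∀ h ∈ H, t (g * h) = t g := fun g h hh =>
    congrArg Quotient.out (QuotientGroup.eq.2 (by simpa using H.inv_mem hh))
  have hball : ∀ {y : E}, ‖y‖ ≤ ‖ϖ‖ ^ n → (ϖ ^ n)⁻¹ • y ∈ unitBall L E := fun {y} hy => by
    rw [mem_unitBall, hϖ.norm_inv_pow_smul_le, mul_one]
    exact hy
  let F₀ : Γ → Reduction (unitBall L E) := fun g => Reduction.mk _ ⟨_, hball (ht g)⟩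
  have hF₀ : IsLocallyConstant F₀ := by
    rw [IsLocallyConstant.iff_eventually_eq]
    intro g₀
    have h1 : ∀ᶠ g in 𝓝 g₀, g₀⁻¹ * g ∈ H :=
      (continuous_const_mul g₀⁻¹).continuousAt.eventually (hH.mem_nhds (by simp [H.one_mem]))
    have hc : Continuous fun g => ‖ρ g x - ρ g₀ x‖ :=
      ((hρ.continuous.comp (continuous_id.prodMk continuous_const)).sub continuous_const).norm
    have h2 : ∀ᶠ g in 𝓝 g₀, ‖ρ g x - ρ g₀ x‖ ≤ ‖ϖ‖ ^ n * ‖ϖ‖ :=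
      hc.continuousAt.eventually (Iic_mem_nhds (by
        simpa using mul_pos (pow_pos hϖ.norm_pos n) hϖ.norm_pos))
    filter_upwards [h1, h2] with g hg1 hg2
    have htg : t g = t g₀ := by
      rw [← hthH g₀ _ hg1, mul_inv_cancel_left]
    refine hϖ.unitBall_mk_eq_iff.2 ?_
    rw [← smul_sub, hϖ.norm_inv_pow_smul_le, htg, sub_sub_sub_cancel_right]
    exact hg2
  obtain ⟨m₀, hm₀⟩ := hinj.exists_coboundary ⟨F₀, hF₀⟩
  obtain ⟨m, rfl⟩ := Reduction.mk_surjective _ m₀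
  refine ⟨m, m.2, fun h hh => ?_⟩
  have h1 := hm₀ h (Reduction.mk _ ⟨_, hball (hx h hh)⟩) fun g => by
    change Reduction.mk _ _ - Reduction.mk _ _ = Reduction.mk _ _
    rw [← map_sub]
    refine congrArg _ (Subtype.ext ?_)
    change (ϖ ^ n)⁻¹ • (ρ (g * h) x - ρ (t (g * h)) x) - (ϖ ^ n)⁻¹ • (ρ g x - ρ (t g) x) =
      ρ g ((ϖ ^ n)⁻¹ • (ρ h x - x))
    rw [← smul_sub, hthH g h hh, sub_sub_sub_cancel_right, map_smul, map_sub, map_mul,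
      Module.End.mul_apply]
  have h2 : Reduction.mk (unitBall L E) (⟨ρ h m, hρ.unitBall_stable h m m.2⟩ - m) =
      Reduction.mk _ ⟨_, hball (hx h hh)⟩ := by
    rw [map_sub]
    exact h1
  have h3 : ‖(ρ h (m : E) - m) - (ϖ ^ n)⁻¹ • (ρ h x - x)‖ ≤ ‖ϖ‖ := hϖ.unitBall_mk_eq_iff.1 h2
  have h4 : ρ h (x - ϖ ^ n • (m : E)) - (x - ϖ ^ n • (m : E)) =
      -(ϖ ^ n • ((ρ h (m : E) - m) - (ϖ ^ n)⁻¹ • (ρ h x - x))) := by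
    rw [smul_sub _ (ρ h (m : E) - m), smul_inv_smul₀ hϖn, map_sub, map_smul, smul_sub]
    abel
  rw [h4, norm_neg, norm_smul, norm_pow, pow_succ]
  exact mul_le_mul_of_nonneg_left h3 (pow_nonneg (norm_nonneg _) _)

/-- An `H`-invariant vector of an injective reduction lifts to approximately invariant vectors. -/
theorem IsUniformizer.exists_approx_invariant_lift (hϖ : IsUniformizer ϖ) {Γ : Type} [Group Γ]
    [TopologicalSpace Γ] [CompactSpace Γ] [IsTopologicalGroup Γ] {E : Type u}
    [NormedAddCommGroup E] [NormedSpace L E] [IsUltrametricDist E] {ρ : Representation L Γ E}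
    (hρ : IsUnitary ρ) (hinj : IsInjectiveSmooth (reduction ρ (unitBall L E) hρ.unitBall_stable))
    {H : Subgroup Γ} (hH : IsOpen (H : Set Γ)) {m : Reduction (unitBall L E)}
    (hm : ∀ h ∈ H, reduction ρ (unitBall L E) hρ.unitBall_stable h m = m) (n : ℕ) :
    ∃ x : unitBall L E, Reduction.mk _ x = m ∧
      ∀ h ∈ H, ‖ρ h (x : E) - x‖ ≤ ‖ϖ‖ ^ (n + 1) := by
  induction n with
  | zero =>
    obtain ⟨x, rfl⟩ := Reduction.mk_surjective _ m
    refine ⟨x, rfl, fun h hh => ?_⟩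
    rw [zero_add, pow_one]
    exact hϖ.unitBall_mk_eq_iff.1 (hm h hh)
  | succ n ih =>
    obtain ⟨x, hxm, hx⟩ := ih
    obtain ⟨y, hy, hxy⟩ := hϖ.improve_invariant hρ hinj hH hx
    have hϖy : ‖ϖ ^ (n + 1) • y‖ ≤ ‖ϖ‖ := by
      rw [norm_smul, norm_pow]
      exact (mul_le_of_le_one_right (by positivity) hy).trans
        (pow_le_of_le_one (norm_nonneg _) hϖ.norm_lt_one.le n.succ_ne_zero)
    refine ⟨⟨x - ϖ ^ (n + 1) • y, (unitBall L E).sub_mem x.2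
      (hϖy.trans hϖ.norm_lt_one.le)⟩, ?_, hxy⟩
    rw [← hxm, hϖ.unitBall_mk_eq_iff]
    simpa using hϖy

variable {Γ : Type v} [Group Γ] {V : Type w} [NormedAddCommGroup V] [NormedSpace L V]
  {ρ : Representation L Γ V}

theorem IsUniformizer.pow_smul_mem (hϖ : IsUniformizer ϖ) {Θ : Submodule (Integers L) V} (n : ℕ)
    {x : V} (hx : x ∈ Θ) : ϖ ^ n • x ∈ Θ :=
  Θ.smul_mem (hϖ.toInt ^ n) hx

/-- If `Θ / ϖΘ` has finitely many `H`-invariants, then so has `Θ / ϖⁿΘ`. -/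
theorem IsUniformizer.exists_finite_approx_invariants (hϖ : IsUniformizer ϖ)
    {Θ : Submodule (Integers L) V} (hΘ : ∀ g, ∀ x ∈ Θ, ρ g x ∈ Θ) {H : Subgroup Γ}
    (hfin : {m | ∀ h ∈ H, reduction ρ Θ hΘ h m = m}.Finite) (n : ℕ) :
    ∃ S : Set V, S.Finite ∧ ∀ y ∈ Θ, (∀ h ∈ H, ∃ z ∈ Θ, ρ h y - y = ϖ ^ n • z) →
      ∃ s ∈ S, ∃ z ∈ Θ, y - s = ϖ ^ n • z := by
  induction n with
  | zero => exact ⟨{0}, Set.finite_singleton 0, fun y hy _ => ⟨0, rfl, y, hy, by simp⟩⟩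
  | succ n ih =>
    obtain ⟨S, hS, hSn⟩ := ih
    let Z : Set Θ := {y | ∀ h ∈ H, ∃ z ∈ Θ, ρ h (y : V) - y = ϖ ^ (n + 1) • z}
    have hQ : (Reduction.mk Θ '' Z).Finite := by
      refine hfin.subset ?_
      rintro _ ⟨y, hy, rfl⟩ h hh
      obtain ⟨z, hz, hyz⟩ := hy h hh
      refine sub_eq_zero.1 ((map_sub (Reduction.mk Θ) ⟨ρ h y, hΘ h y y.2⟩ y).symm.trans ?_)
      refine hϖ.mk_eq_zero_iff.2 ⟨ϖ ^ n • z, hϖ.pow_smul_mem n hz, ?_⟩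
      rw [smul_smul, ← pow_succ']
      exact hyz
    -- Representatives are chosen among the vectors that are themselves invariant modulo `ϖⁿ⁺¹`.
    let T : Set Θ := Function.invFunOn (Reduction.mk Θ) Z '' (Reduction.mk Θ '' Z)
    refine ⟨Set.image2 (fun (t : Θ) s => (t : V) + ϖ • s) T S,
      (hQ.image _).image2 _ hS, fun y hyΘ hy => ?_⟩
    have hex : ∃ a ∈ Z, Reduction.mk Θ a = Reduction.mk Θ ⟨y, hyΘ⟩ := ⟨⟨y, hyΘ⟩, hy, rfl⟩
    have htZ := Function.invFunOn_mem hex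
    have hteq := Function.invFunOn_eq hex
    have htT : Function.invFunOn (Reduction.mk Θ) Z (Reduction.mk Θ ⟨y, hyΘ⟩) ∈ T :=
      ⟨_, ⟨⟨y, hyΘ⟩, hy, rfl⟩, rfl⟩
    set t := Function.invFunOn (Reduction.mk Θ) Z (Reduction.mk Θ ⟨y, hyΘ⟩)
    rw [eq_comm, ← sub_eq_zero, ← map_sub, hϖ.mk_eq_zero_iff] at hteq
    obtain ⟨y', hy', hyy'⟩ := hteq
    replace hyy' : y - t = ϖ • y' := hyy'
    obtain ⟨s, hs, z, hz, hsz⟩ := hSn y' hy' fun h hh => by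
      obtain ⟨z₁, hz₁, h₁⟩ := hy h hh
      obtain ⟨z₂, hz₂, h₂⟩ := htZ h hh
      refine ⟨z₁ - z₂, Θ.sub_mem hz₁ hz₂, ?_⟩
      apply smul_right_injective V hϖ.ne_zero
      dsimp only
      rw [smul_sub, ← map_smul, ← hyy', smul_smul, ← pow_succ', smul_sub, ← h₁, ← h₂, map_sub]
      abel
    refine ⟨_, ⟨t, htT, s, hs, rfl⟩, z, hz, ?_⟩
    rw [← sub_sub, hyy', ← smul_sub, hsz, smul_smul, ← pow_succ']

/-- Finiteness of the invariants of an injective reduction of the unit ball follows from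
finiteness of those of the reduction of any other open bounded lattice. -/
theorem IsUniformizer.finite_invariants (hϖ : IsUniformizer ϖ) {Γ : Type} [Group Γ]
    [TopologicalSpace Γ] [CompactSpace Γ] [IsTopologicalGroup Γ] {E : Type u}
    [NormedAddCommGroup E] [NormedSpace L E] [IsUltrametricDist E] {ρ : Representation L Γ E}
    (hρ : IsUnitary ρ) (hinj : IsInjectiveSmooth (reduction ρ (unitBall L E) hρ.unitBall_stable))
    {H : Subgroup Γ} (hH : IsOpen (H : Set Γ)) {Θ : Submodule (Integers L) E}
    (hΘ : ∀ g, ∀ x ∈ Θ, ρ g x ∈ Θ) (hΘo : IsOpen (Θ : Set E))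
    (hΘb : Bornology.IsBounded (Θ : Set E))
    (hfin : {m | ∀ h ∈ H, reduction ρ Θ hΘ h m = m}.Finite) :
    {m | ∀ h ∈ H, reduction ρ (unitBall L E) hρ.unitBall_stable h m = m}.Finite := by
  -- `ϖᵃ E⁰ ⊆ Θ` and `ϖᵇ Θ ⊆ ϖ E⁰`.
  obtain ⟨a, ha⟩ : ∃ a : ℕ, ∀ x : E, ‖x‖ ≤ 1 → ϖ ^ a • x ∈ Θ := by
    obtain ⟨ε, hε, hball⟩ := Metric.isOpen_iff.1 hΘo 0 Θ.zero_mem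
    obtain ⟨a, ha⟩ := hϖ.exists_pow_mul_le 1 (half_pos hε)
    refine ⟨a, fun x hx => hball ?_⟩
    rw [mem_ball_zero_iff, norm_smul, norm_pow]
    rw [mul_one] at ha
    exact ((mul_le_of_le_one_right (by positivity) hx).trans ha).trans_lt (half_lt_self hε)
  obtain ⟨b, hb⟩ : ∃ b : ℕ, ∀ z ∈ Θ, ‖ϖ ^ b • z‖ ≤ ‖ϖ‖ := by
    obtain ⟨C, hC⟩ := hΘb.exists_norm_le
    obtain ⟨b, hb⟩ := hϖ.exists_pow_mul_le C hϖ.norm_pos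
    refine ⟨b, fun z hz => le_trans ?_ hb⟩
    rw [norm_smul, norm_pow]
    exact mul_le_mul_of_nonneg_left (hC z hz) (by positivity)
  obtain ⟨S, hS, hSn⟩ := hϖ.exists_finite_approx_invariants hΘ hfin (a + b)
  refine (hS.biUnion (t := fun s => {m | ∃ x : unitBall L E, Reduction.mk _ x = m ∧
    ‖(x : E) - (ϖ ^ a)⁻¹ • s‖ ≤ ‖ϖ‖}) fun s _ => Set.Subsingleton.finite ?_).subset ?_
  · rintro _ ⟨x, rfl, hx⟩ _ ⟨y, rfl, hy⟩
    rw [hϖ.unitBall_mk_eq_iff, ← sub_add_sub_cancel _ ((ϖ ^ a)⁻¹ • s)]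
    exact (IsUltrametricDist.norm_add_le_max _ _).trans (max_le hx (by rwa [norm_sub_rev]))
  · intro m hm
    obtain ⟨x, hxm, hx⟩ := hϖ.exists_approx_invariant_lift hρ hinj hH hm (a + b)
    obtain ⟨s, hs, z, hz, hsz⟩ := hSn (ϖ ^ a • (x : E)) (ha x x.2) fun h hh => by
      refine ⟨ϖ ^ a • (ϖ ^ (a + b))⁻¹ • (ρ h (x : E) - x), ha _ ?_, ?_⟩
      · rw [hϖ.norm_inv_pow_smul_le, mul_one]
        exact (hx h hh).trans
          (pow_le_pow_of_le_one (norm_nonneg _) hϖ.norm_lt_one.le (Nat.le_succ _))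
      · rw [smul_comm (ϖ ^ (a + b)), smul_inv_smul₀ (pow_ne_zero _ hϖ.ne_zero), map_smul, smul_sub]
    refine Set.mem_biUnion hs ⟨x, hxm, ?_⟩
    have h : (x : E) - (ϖ ^ a)⁻¹ • s = ϖ ^ b • z := by
      apply smul_right_injective E (pow_ne_zero a hϖ.ne_zero)
      dsimp only
      rw [smul_sub, smul_inv_smul₀ (pow_ne_zero _ hϖ.ne_zero), hsz, smul_smul, pow_add]
    rw [h]
    exact hb z hz

end Finiteness

/-! ### Fixed vectors of pro-p groups in characteristic p -/

/-- Let `H` be a group of automorphisms whose elements satisfy `g ^ pⁿ → 1`. In a nonzero stable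
subspace of a smooth representation in characteristic `p` it has a nonzero fixed vector: the
additive group generated by an orbit is a finite `p`-group on which `H` acts through a
`p`-group. -/
theorem IsSmooth.exists_fixed_vector {k : Type u} [Field k] {Γ : Type v} [Group Γ]
    [TopologicalSpace Γ] [CompactSpace Γ] [ContinuousMul Γ] {M : Type w} [AddCommGroup M]
    [Module k M] {σ : Representation k Γ M} (hσ : IsSmooth σ) {p : ℕ} [Fact p.Prime]
    (hp : (p : k) = 0) {H : Subgroup Γ}
    (hH : ∀ g ∈ H, Tendsto (fun n : ℕ => g ^ p ^ n) atTop (𝓝 1)) {N : Submodule k M}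
    (hN : ∀ g, ∀ m ∈ N, σ g m ∈ N) (hN0 : N ≠ ⊥) :
    ∃ m ∈ N, m ≠ 0 ∧ ∀ h ∈ H, σ h m = m := by
  obtain ⟨m, hm, hm0⟩ := N.ne_bot_iff.1 hN0
  let R : Set M := Set.range fun g => σ g m
  have hR : R.Finite := (hσ.isLocallyConstant m).range_finite
  let A : AddSubgroup M := AddSubgroup.closure R
  have hmA : m ∈ A := AddSubgroup.subset_closure ⟨1, by simp⟩
  have hAN : ∀ x ∈ A, x ∈ N := by
    have : A ≤ N.toAddSubgroup := (AddSubgroup.closure_le _).2 (by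
      rintro _ ⟨g, rfl⟩
      exact hN g m hm)
    exact this
  have hAstab : ∀ g, ∀ x ∈ A, σ g x ∈ A := by
    intro g
    have : A ≤ A.comap (σ g).toAddMonoidHom := (AddSubgroup.closure_le _).2 (by
      rintro _ ⟨g', rfl⟩
      exact AddSubgroup.subset_closure ⟨g * g', by simp⟩)
    exact this
  have hpM : ∀ x : M, p • x = 0 := fun x => by
    rw [← Nat.cast_smul_eq_nsmul k, hp, zero_smul]
  have hAfin : Finite A := by
    have hfg : AddGroup.FG A := (AddGroup.fg_iff_addSubgroup_fg A).2 ⟨hR.toFinset, by simp [A]⟩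
    have : Module.Finite ℤ A := Module.Finite.iff_addGroup_fg.2 hfg
    refine AddCommGroup.finite_of_fg_isAddTorsion A fun x => ?_
    exact isOfFinAddOrder_iff_nsmul_eq_zero.2
      ⟨p, (Fact.out : p.Prime).pos, Subtype.ext (hpM x)⟩
  have hcard : p ∣ Nat.card A := by
    have h : addOrderOf (⟨m, hmA⟩ : A) = p :=
      addOrderOf_eq_prime (Subtype.ext (hpM m)) fun h => hm0 (congrArg Subtype.val h)
    rw [← h]
    exact addOrderOf_dvd_natCard _
  let _ : MulAction H A :=
    { smul := fun h x => ⟨σ h x, hAstab h x x.2⟩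
      one_smul := fun x => Subtype.ext (by
        change σ (1 : Γ) x = x
        simp)
      mul_smul := fun h h' x => Subtype.ext (by
        change σ ((h : Γ) * h') x = σ h (σ h' x)
        simp) }
  have hsmul : ∀ (h : H) (x : A), ((h • x : A) : M) = σ h x := fun _ _ => rfl
  have hpgroup : IsPGroup p (MulAction.toPermHom H A).range := by
    rintro ⟨_, h, rfl⟩
    have hev : ∀ᶠ n in atTop, ∀ x ∈ R, σ ((h : Γ) ^ p ^ n) x = x :=
      (eventually_all_finite hR).2 fun x _ =>
        (hH h h.2).eventually ((hσ x).mem_nhds (by simp))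
    obtain ⟨n, hn⟩ := hev.exists
    have hnA : A ≤ AddMonoidHom.eqLocus (σ ((h : Γ) ^ p ^ n)).toAddMonoidHom (AddMonoidHom.id M) :=
      (AddSubgroup.closure_le _).2 hn
    refine ⟨n, Subtype.ext ?_⟩
    change (MulAction.toPermHom H A h) ^ p ^ n = 1
    rw [← map_pow]
    ext x
    exact hnA x.2
  have h0 : (0 : A) ∈ MulAction.fixedPoints (MulAction.toPermHom H A).range A := by
    rintro ⟨_, h, rfl⟩
    exact Subtype.ext (map_zero (σ h))
  obtain ⟨b, hb, hb0⟩ := hpgroup.exists_fixed_point_of_prime_dvd_card_of_fixed_point A hcard h0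
  refine ⟨b, hAN b b.2, fun h => hb0 (Subtype.ext h.symm), fun h hh => ?_⟩
  exact congrArg Subtype.val (hb ⟨_, ⟨h, hh⟩, rfl⟩)

/-! ### The first congruence subgroup of `GL₂(ℤ_p)` -/

section Congruence

variable (p : ℕ) [Fact p.Prime]

/-- The subgroup of `K` of the matrices congruent to `1` modulo `p`. -/
noncomputable def congruenceSubgroup : Subgroup (K p) :=
  (Matrix.GeneralLinearGroup.map (n := Fin 2) (PadicInt.toZMod (p := p))).ker

variable {p}

theorem toZMod_eq_zero_iff {a : ℤ_[p]} : PadicInt.toZMod a = 0 ↔ ‖a‖ < 1 := by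
  rw [← RingHom.mem_ker, PadicInt.ker_toZMod, IsLocalRing.mem_maximalIdeal,
    PadicInt.mem_nonunits]

theorem mem_congruenceSubgroup {g : K p} :
    g ∈ congruenceSubgroup p ↔ ∀ i j, ‖g i j - (1 : Matrix (Fin 2) (Fin 2) ℤ_[p]) i j‖ < 1 := by
  rw [congruenceSubgroup, MonoidHom.mem_ker, Matrix.GeneralLinearGroup.ext_iff]
  refine forall_congr' fun i => forall_congr' fun j => ?_
  rw [← toZMod_eq_zero_iff, map_sub, sub_eq_zero, Matrix.GeneralLinearGroup.map_apply]
  have h1 : PadicInt.toZMod ((1 : Matrix (Fin 2) (Fin 2) ℤ_[p]) i j) =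
      (1 : Matrix (Fin 2) (Fin 2) (ZMod p)) i j := by
    rw [Matrix.one_apply, Matrix.one_apply]
    split_ifs <;> simp
  rw [h1]
  rfl

theorem continuous_entry {R : Type*} [CommRing R] [TopologicalSpace R] (i j : Fin 2) :
    Continuous fun g : GL (Fin 2) R => g i j :=
  Units.continuous_val.matrix_elem i j

theorem isOpen_congruenceSubgroup : IsOpen (congruenceSubgroup p : Set (K p)) := by
  have h : (congruenceSubgroup p : Set (K p)) =
      ⋂ i, ⋂ j, {g | ‖g i j - (1 : Matrix (Fin 2) (Fin 2) ℤ_[p]) i j‖ < 1} := by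
    ext g
    simp [mem_congruenceSubgroup]
  rw [h]
  refine isOpen_iInter_of_finite fun i => isOpen_iInter_of_finite fun j => ?_
  exact isOpen_lt ((continuous_entry i j).sub continuous_const).norm continuous_const

/-- A matrix congruent to `1` modulo `p` has its `pⁿ`-th power congruent to `1` modulo `pⁿ⁺¹`. -/
theorem exists_pow_prime_pow_eq (X : Matrix (Fin 2) (Fin 2) ℤ_[p]) (n : ℕ) :
    ∃ Y : Matrix (Fin 2) (Fin 2) ℤ_[p],
      (1 + (p : ℤ_[p]) • X) ^ p ^ n = 1 + (p : ℤ_[p]) ^ (n + 1) • Y := by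
  obtain ⟨q, hq⟩ := dvd_sub_pow_of_dvd_sub (R := Polynomial ℤ_[p]) (p := p)
    (a := 1 + (p : Polynomial ℤ_[p]) * Polynomial.X) (b := 1) ⟨Polynomial.X, by ring⟩ n
  refine ⟨Polynomial.aeval X q, ?_⟩
  have h := congrArg (Polynomial.aeval X) hq
  simp only [map_sub, map_pow, map_add, map_mul, map_one, one_pow, map_natCast,
    Polynomial.aeval_X] at h
  rw [sub_eq_iff_eq_add'] at h
  have hc : ∀ (m : ℕ) (Z : Matrix (Fin 2) (Fin 2) ℤ_[p]),
      (p : ℤ_[p]) ^ m • Z = (p : Matrix (Fin 2) (Fin 2) ℤ_[p]) ^ m * Z := fun m Z => by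
    rw [← Nat.cast_pow, ← Nat.cast_pow, Nat.cast_smul_eq_nsmul, nsmul_eq_mul]
  have h1 := hc 1 X
  rw [pow_one, pow_one] at h1
  rw [h1, h, hc]

theorem tendsto_pow_prime_pow {g : K p} (hg : g ∈ congruenceSubgroup p) :
    Tendsto (fun n : ℕ => g ^ p ^ n) atTop (𝓝 1) := by
  have hval : ∀ {g : K p}, g ∈ congruenceSubgroup p → Tendsto
      (fun n : ℕ => ((g ^ p ^ n : K p) : Matrix (Fin 2) (Fin 2) ℤ_[p])) atTop (𝓝 1) := by
    intro g hg
    rw [mem_congruenceSubgroup] at hg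
    simp_rw [PadicInt.norm_lt_one_iff_dvd] at hg
    choose X hX using hg
    have hgX : (g : Matrix (Fin 2) (Fin 2) ℤ_[p]) = 1 + (p : ℤ_[p]) • Matrix.of X := by
      ext i j
      rw [Matrix.add_apply, Matrix.smul_apply, Matrix.of_apply, smul_eq_mul, ← hX]
      exact (add_sub_cancel _ _).symm
    choose Y hY using exists_pow_prime_pow_eq (Matrix.of X)
    refine tendsto_pi_nhds.2 fun i => tendsto_pi_nhds.2 fun j => ?_
    rw [tendsto_iff_norm_sub_tendsto_zero]
    have hlim : Tendsto (fun n : ℕ => ‖(p : ℤ_[p])‖ ^ (n + 1)) atTop (𝓝 0) :=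
      (tendsto_pow_atTop_nhds_zero_of_lt_one (norm_nonneg _)
        (PadicInt.norm_lt_one_iff_dvd _ |>.2 dvd_rfl)).comp
        (tendsto_add_atTop_nat 1)
    refine squeeze_zero (fun _ => norm_nonneg _) (fun n => ?_) hlim
    rw [Units.val_pow_eq_pow_val, hgX, hY, Matrix.add_apply, add_sub_cancel_left,
      Matrix.smul_apply, smul_eq_mul, norm_mul, norm_pow]
    exact mul_le_of_le_one_right (by positivity) (PadicInt.norm_le_one _)
  rw [Units.isEmbedding_embedProduct.tendsto_nhds_iff]
  refine Tendsto.prodMk_nhds (hval hg) ?_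
  refine (MulOpposite.continuous_op.tendsto _).comp ?_
  refine (hval ((congruenceSubgroup p).inv_mem hg)).congr fun n => ?_
  rw [inv_pow]

theorem continuous_inclK : Continuous (inclK p) := by
  refine Continuous.units_map _ ?_
  exact continuous_id.matrix_map continuous_subtype_val

/-- The image of the first congruence subgroup is open in `G`. -/
theorem isOpen_map_congruenceSubgroup :
    IsOpen (((congruenceSubgroup p).map (inclK p) : Subgroup (G p)) : Set (G p)) := by
  refine Subgroup.isOpen_of_mem_nhds _ (g := 1) ?_
  have hev : ∀ᶠ g : G p in 𝓝 1, ∀ i j, ‖g i j - (1 : Matrix (Fin 2) (Fin 2) ℚ_[p]) i j‖ < 1 := by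
    refine eventually_all.2 fun i => eventually_all.2 fun j => ?_
    have hc : Continuous fun g : G p => ‖g i j - (1 : Matrix (Fin 2) (Fin 2) ℚ_[p]) i j‖ :=
      ((continuous_entry i j).sub continuous_const).norm
    exact hc.continuousAt.eventually (Iio_mem_nhds (by simp))
  have hev' : ∀ᶠ g : G p in 𝓝 1,
      ∀ i j, ‖g⁻¹ i j - (1 : Matrix (Fin 2) (Fin 2) ℚ_[p]) i j‖ < 1 := by
    have h : Tendsto (fun g : G p => g⁻¹) (𝓝 1) (𝓝 1) := by
      simpa using (continuous_inv.tendsto (1 : G p))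
    exact h.eventually hev
  have hint : ∀ M : Matrix (Fin 2) (Fin 2) ℚ_[p],
      (∀ i j, ‖M i j - (1 : Matrix (Fin 2) (Fin 2) ℚ_[p]) i j‖ < 1) →
      ∃ M₀ : Matrix (Fin 2) (Fin 2) ℤ_[p], M₀.map (algebraMap ℤ_[p] ℚ_[p]) = M := by
    intro M hM
    have h1 : ∀ i j, ‖M i j‖ ≤ 1 := by
      intro i j
      rw [← sub_add_cancel (M i j) ((1 : Matrix (Fin 2) (Fin 2) ℚ_[p]) i j)]
      refine (IsUltrametricDist.norm_add_le_max _ _).trans (max_le (hM i j).le ?_)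
      rw [Matrix.one_apply]
      split_ifs <;> simp
    exact ⟨Matrix.of fun i j => ⟨M i j, h1 i j⟩, rfl⟩
  filter_upwards [hev, hev'] with g hg hg'
  obtain ⟨A, hA⟩ := hint _ hg
  obtain ⟨B, hB⟩ := hint _ hg'
  have hinj : Function.Injective
      (fun M : Matrix (Fin 2) (Fin 2) ℤ_[p] => M.map (algebraMap ℤ_[p] ℚ_[p])) :=
    Matrix.map_injective (FaithfulSMul.algebraMap_injective _ _)
  have hAB : A * B = 1 := hinj (by
    dsimp only
    rw [Matrix.map_mul, hA, hB, Matrix.map_one _ (map_zero _) (map_one _)]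
    exact g.mul_inv)
  have hBA : B * A = 1 := hinj (by
    dsimp only
    rw [Matrix.map_mul, hA, hB, Matrix.map_one _ (map_zero _) (map_one _)]
    exact g.inv_mul)
  refine ⟨⟨A, B, hAB, hBA⟩, ?_, Units.ext hA⟩
  refine mem_congruenceSubgroup.2 fun i j => ?_
  have h := hg i j
  rw [← hA] at h
  rw [PadicInt.norm_def, PadicInt.coe_sub]
  convert h using 3
  · rfl
  · rw [Matrix.one_apply, Matrix.one_apply]
    split_ifs <;> simp

end Congruence

/-! ### Locally compact coefficient fields -/

section LocalField

variable (L : Type u) [NormedField L] [IsUltrametricDist L] [ProperSpace L]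

theorem exists_isUniformizer (h : ∃ a : L, a ≠ 0 ∧ ‖a‖ < 1) : ∃ ϖ : L, IsUniformizer ϖ := by
  obtain ⟨a, ha0, ha1⟩ := h
  have hc : IsCompact (Metric.ball (0 : L) 1) :=
    (isCompact_closedBall (0 : L) 1).of_isClosed_subset (IsUltrametricDist.isClosed_ball _ _)
      Metric.ball_subset_closedBall
  obtain ⟨ϖ, hϖ, hmax⟩ := hc.exists_isMaxOn ⟨a, by simpa using ha1⟩
    (f := fun x : L => ‖x‖) continuous_norm.continuousOn
  refine ⟨ϖ, fun h0 => ?_, by simpa using hϖ, fun b hb => hmax (by simpa using hb)⟩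
  have h : ‖a‖ ≤ ‖ϖ‖ := hmax (show a ∈ Metric.ball (0 : L) 1 by simpa using ha1)
  rw [h0, norm_zero, norm_le_zero_iff] at h
  exact ha0 h

theorem finite_residue : Finite (Residue L) := by
  obtain ⟨t, ht, htfin, hcover⟩ :=
    (isCompact_closedBall (0 : L) 1).finite_cover_balls zero_lt_one
  have : Finite t := htfin
  have hint : ∀ x ∈ t, x ∈ Integers L := fun x hx =>
    (mem_integers L).2 (by simpa using ht hx)
  refine Finite.of_surjective
    (fun x : t => IsLocalRing.residue (Integers L) ⟨x, hint x x.2⟩) fun c => ?_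
  obtain ⟨a, rfl⟩ := IsLocalRing.residue_surjective c
  have ha : (a : L) ∈ Metric.closedBall (0 : L) 1 := by simpa using (mem_integers L).1 a.2
  obtain ⟨x, hx, hax⟩ := Set.mem_iUnion₂.1 (hcover ha)
  refine ⟨⟨x, hx⟩, ?_⟩
  rw [← sub_eq_zero, ← map_sub, residue_eq_zero_iff]
  rw [Metric.mem_ball', dist_eq_norm] at hax
  exact hax

end LocalField

/-! ### Injectivity and separating functionals -/

theorem IsInjectiveSmooth.of_equiv {k : Type u} [Field k] {Γ : Type v} [Group Γ]
    [TopologicalSpace Γ] {M W : Type u} [AddCommGroup M] [Module k M] [AddCommGroup W] [Module k W]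
    {σ : Representation k Γ M} {ω : Representation k Γ W} (hω : IsInjectiveSmooth ω)
    (e : Representation.Equiv σ ω) : IsInjectiveSmooth σ where
  smooth m := by
    have h : {g | σ g m = m} = {g | ω g (e.toLinearEquiv m) = e.toLinearEquiv m} := by
      ext g
      have hg : e.toLinearEquiv (σ g m) = ω g (e.toLinearEquiv m) :=
        LinearMap.congr_fun (e.isIntertwining' g) m
      rw [Set.mem_ofPred_eq, Set.mem_ofPred_eq, ← hg, e.toLinearEquiv.injective.eq_iff]
    rw [h]
    exact hω.smooth _
  exists_extension A B _ _ _ _ α β hα hβ i f hi := by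
    obtain ⟨h, hh⟩ := hω.exists_extension A B α β hα hβ i (e.toIntertwiningMap.comp f) hi
    refine ⟨e.symm.toIntertwiningMap.comp h, fun a => ?_⟩
    change e.toLinearEquiv.symm (h (i a)) = f a
    rw [hh]
    exact e.toLinearEquiv.symm_apply_apply (f a)

/-- The translates of functionals on a smooth representation of `K` in characteristic `p` separate
vectors as soon as the functionals separate the vectors fixed by the first congruence subgroup: a
nonzero stable subspace on which they vanish would contain such a fixed vector. The zero functional
is added to make the number of functionals positive. -/
theorem exists_separating_functionals {p : ℕ} [Fact p.Prime] {k : Type u} [Field k]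
    (hp : (p : k) = 0) {M : Type v} [AddCommGroup M] [Module k M] {σ : Representation k (K p) M}
    (hσ : IsSmooth σ) (hfin : {m | ∀ h ∈ congruenceSubgroup p, σ h m = m}.Finite) :
    ∃ (d : ℕ) (l : Fin (d + 1) → M →ₗ[k] k), ∀ m, (∀ g i, l i (σ g m) = 0) → m = 0 := by
  let I : Submodule k M := invariants (σ.comp (congruenceSubgroup p).subtype)
  have hI : ∀ m, m ∈ I ↔ ∀ h ∈ congruenceSubgroup p, σ h m = m := fun m =>
    ⟨fun hm h hh => hm ⟨h, hh⟩, fun hm h => hm h h.2⟩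
  have : Finite I := hfin.subset fun m hm => (hI m).1 hm
  obtain ⟨f, hf⟩ := LinearMap.exists_extend (Module.finBasis k I).equivFun.toLinearMap
  refine ⟨Module.finrank k I, Fin.cons 0 fun i => LinearMap.proj i ∘ₗ f, ?_⟩
  let N : Submodule k M := ⨅ g, ⨅ i, LinearMap.ker
    ((Fin.cons 0 fun i => LinearMap.proj i ∘ₗ f : Fin (Module.finrank k I + 1) → M →ₗ[k] k) i ∘ₗ
      σ g)
  have hN : ∀ m, m ∈ N ↔ ∀ g i, (Fin.cons 0 fun i => LinearMap.proj i ∘ₗ f :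
      Fin (Module.finrank k I + 1) → M →ₗ[k] k) i (σ g m) = 0 := by
    intro m
    simp only [N, Submodule.mem_iInf, LinearMap.mem_ker, LinearMap.comp_apply]
  suffices h : N = ⊥ by
    intro m hm
    rw [← hN, h] at hm
    exact hm
  by_contra hne
  obtain ⟨m, hmN, hm0, hm⟩ := hσ.exists_fixed_vector hp
    (fun g hg => tendsto_pow_prime_pow hg) (N := N) (fun g m hm => by
      rw [hN] at hm ⊢
      intro g' i
      rw [← Module.End.mul_apply, ← map_mul]
      exact hm _ i) hne
  refine hm0 ?_
  have hfm : (Module.finBasis k I).equivFun ⟨m, (hI m).2 hm⟩ = 0 := by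
    rw [← LinearEquiv.coe_toLinearMap, ← hf]
    ext i
    have := (hN m).1 hmN 1 i.succ
    rwa [Fin.cons_succ, map_one] at this
  exact congrArg Subtype.val ((LinearEquiv.map_eq_zero_iff _).1 hfm)

end PadicLift

theorem mainTheorem6 (p : ℕ) [Fact p.Prime]
    -- a finite extension of `ℚ_p` with the norm extending the `p`-adic one
    (L : Type u) [NormedField L] [NormedAlgebra ℚ_[p] L] [FiniteDimensional ℚ_[p] L]
    [IsUltrametricDist L]
    -- a smooth representation `τ` of `G`
    {T : Type u} [AddCommGroup T] [Module (PadicLift.Residue L) T]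
    (τ : Representation (PadicLift.Residue L) (PadicLift.G p) T)
    (_hτ : PadicLift.IsSmooth τ)
    -- a smooth representation `ω` of `G` containing `τ`, on which the scalar `p` acts trivially, and
    -- whose restriction to `K` is an injective envelope of the `K`-socle of `τ`
    {W : Type u} [AddCommGroup W] [Module (PadicLift.Residue L) W]
    (ω : Representation (PadicLift.Residue L) (PadicLift.G p) W)
    (_hω : PadicLift.IsSmooth ω)
    (ι : Representation.IntertwiningMap τ ω) (_hι : Function.Injective ι)
    (_henv : PadicLift.IsInjectiveEnvelope
      (PadicLift.socle (PadicLift.resK τ)).toRepresentation (PadicLift.resK ω))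
    (_hωp : ω (PadicLift.scalarP p) = 1)
    -- an admissible unitary Banach space representation `(E, ‖·‖)` of `G` lifting `ω`
    {E : Type u} [NormedAddCommGroup E] [NormedSpace L E] [IsUltrametricDist E] [CompleteSpace E]
    (ρ : Representation L (PadicLift.G p) E) (hρ : PadicLift.IsAdmissibleUnitary ρ)
    (_hnorm : ∀ x : E, ∃ a : L, ‖x‖ = ‖a‖)
    (_hρp : ρ (PadicLift.scalarP p) = 1)
    (_hred : Nonempty (Representation.Equiv
      (PadicLift.reduction ρ (PadicLift.unitBall L E) hρ.unitBall_stable) ω)) :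
    ∃ r : ℕ, 0 < r ∧ PadicLift.IsIsometricToDirectSummand (PadicLift.resK ρ)
      (PadicLift.continuousFunctions L (PadicLift.K p) r) := by
  have : ProperSpace L := FiniteDimensional.proper ℚ_[p] L
  have : CompleteSpace L := FiniteDimensional.complete ℚ_[p] L
  have hpnorm : ‖(p : L)‖ < 1 := by
    rw [← map_natCast (algebraMap ℚ_[p] L), norm_algebraMap']
    exact Padic.norm_p_lt_one
  have hp0 : (p : L) ≠ 0 := by
    rw [← map_natCast (algebraMap ℚ_[p] L), Ne, map_eq_zero]
    exact Nat.cast_ne_zero.2 (Fact.out : p.Prime).ne_zero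
  obtain ⟨ϖ, hϖ⟩ := PadicLift.exists_isUniformizer L ⟨p, hp0, hpnorm⟩
  have hpk : (p : PadicLift.Residue L) = 0 := by
    rw [← map_natCast (IsLocalRing.residue (PadicLift.Integers L)),
      PadicLift.residue_eq_zero_iff]
    exact hpnorm
  -- Finite dimensional spaces over the residue field are finite sets, as it is itself finite.
  have hfink : Finite (PadicLift.Residue L) := PadicLift.finite_residue L
  have hK : PadicLift.IsUnitary (PadicLift.resK ρ) :=
    ⟨hρ.continuous.comp ((PadicLift.continuous_inclK.comp continuous_fst).prodMk continuous_snd),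
      fun g x => hρ.norm_map _ x⟩
  obtain ⟨e⟩ := _hred
  have hinj : PadicLift.IsInjectiveSmooth (PadicLift.reduction (PadicLift.resK ρ)
      (PadicLift.unitBall L E) hK.unitBall_stable) :=
    _henv.1.of_equiv (Representation.Equiv.mk e.toLinearEquiv
      fun g => e.isIntertwining' (PadicLift.inclK p g))
  obtain ⟨Θ, hΘ, hΘo, hΘb, hΘa⟩ := hρ.exists_lattice
  have hfin : {m | ∀ h ∈ PadicLift.congruenceSubgroup p, PadicLift.reduction (PadicLift.resK ρ) Θ
      (fun g => hΘ (PadicLift.inclK p g)) h m = m}.Finite := by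
    have := hΘa.finite_invariants _ PadicLift.isOpen_map_congruenceSubgroup
    have hfin := Module.finite_of_finite (PadicLift.Residue L)
      (M := Representation.invariants ((PadicLift.reduction ρ Θ hΘ).comp
        ((PadicLift.congruenceSubgroup p).map (PadicLift.inclK p)).subtype))
    refine Set.Finite.subset hfin fun m hm => ?_
    rintro ⟨_, h, hh, rfl⟩
    exact hm h hh
  obtain ⟨d, l, hl⟩ := PadicLift.exists_separating_functionals hpk hinj.smooth
    (hϖ.finite_invariants hK hinj PadicLift.isOpen_congruenceSubgroup _ hΘo hΘb hfin)
  exact ⟨d + 1, d.succ_pos, hϖ.isIsometricToDirectSummand _ hK _hnorm hinj l hl⟩
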